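/- **Setting.** Let $d=m+k$ with $k\ge 1$, and let $Q$ be a non-degenerate quadratic form on $\mathbb R^d=\mathbb R^m\oplus\mathbb R^{k}$, possibly indefinite, for which this direct sum is orthogonal. A *$Q$-ball* (for any quadratic form $Q$ on $\mathbb R^d$, possibly degenerate) is a region $\{x : Q(x)\le\varphi(x)+D\}$ with $\varphi$ a linear functional and $D\in\mathbb R$; its boundary is a *$Q$-sphere*. A finite set $X\subset\mathbb R^d$ is in *spacelike position* for $Q$ if $Q(x-y)>0$ for all distinct $x,y\in X$, and in *generic position* for $Q$ if no $d+1$ of its points lie in an affine hyperplane and no $d+2$ of its points lie on a $Q$-sphere. A *$Q$-Delaunay decomposition* of a finite set $X$ in spacelike position is a decomposition of the convex hull $\mathrm{CH}(X)$ into convex polytopal cells (a finite polyhedral complex) with $0$-skeleton $X$, such that each cell is inscribed in a $Q$-ball whose interior contains no point of $X$, this ball being unique for each $d$-dimensional cell; a cell is inscribed in a ball if it is contained in the ball and meets its boundary exactly in the vertices of the cell. If there is exactly one such decomposition, it is denoted $\mathrm{Del}_Q(X)$. **Theorem.** Let $n\ge d+1$ and let $p_i(t)=(y_i(t),z_i(t))\in\mathbb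 R^m\oplus\mathbb R^k$, $1\le i\le n$, be smooth paths defined for $t\ge 0$ with $z_i(0)=0$. Put $X_t=\{p_1(t),\dots,p_n(t)\}$, let $q_i=(y_i(0),z_i'(0))$ and $X=\{q_1,\dots,q_n\}$, and let $\mathcal Q$ be the degenerate quadratic form $\mathcal Q(y,z)=Q(y,0)$. Assume that the points $q_1,\dots,q_n$ are pairwise distinct and that $X$ is in spacelike and generic position for $\mathcal Q$. Then $\mathrm{Del}_{\mathcal Q}(X)$ exists and is unique, and for all sufficiently small $t>0$ the following hold: $X_t$ is in spacelike and generic position for $Q$; $\mathrm{Del}_Q(X_t)$ exists and is unique; there is a homeomorphism $h:\mathrm{CH}(X_t)\to\mathrm{CH}(X)$ with $h(p_i(t))=q_i$ for all $i$ that is affine on each cell of $\mathrm{Del}_Q(X_t)$ and takes the cells of $\mathrm{Del}_Q(X_t)$ onto the cells of $\mathrm{Del}_{\mathcal Q}(X)$; and, for every $I\subseteq\{1,\dots,n\}$, the convex hull of $\{p_i(t): i\in I\}$ is a cell of $\mathrm{Del}_Q(X_t)$ if and only if the convex hull of $\{q_i: i\in I\}$ is a cell of $\mathrm{Del}_{\mathcal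 Q}(X)$. -/

import Mathlib

open scoped ContDiff Topology

section Delaunay

variable {E : Type*} [NormedAddCommGroup E] [NormedSpace ℝ E]

/-- The region `{x | Q x ≤ φ x + D}` of a linear functional `φ` and a constant `D`. -/
def qBall (Q : QuadraticForm ℝ E) (φ : E →ₗ[ℝ] ℝ) (D : ℝ) : Set E :=
  {x | Q x ≤ φ x + D}

/-- `B` is a `Q`-ball. Its boundary `frontier B` is then a `Q`-sphere. -/
def IsQBall (Q : QuadraticForm ℝ E) (B : Set E) : Prop :=
  ∃ (φ : E →ₗ[ℝ] ℝ) (D : ℝ), B = qBall Q φ D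

/-- Spacelike position: any two distinct points have positive squared `Q`-distance. -/
def SpacelikePosition (Q : QuadraticForm ℝ E) (X : Set E) : Prop :=
  ∀ x ∈ X, ∀ y ∈ X, x ≠ y → 0 < Q (x - y)

/-- Generic position, where `d` is the dimension of `E`: no `d + 1` points of `X` lie in an affine
hyperplane and no `d + 2` points of `X` lie on a `Q`-sphere. -/
def GenericPosition (Q : QuadraticForm ℝ E) (X : Set E) : Prop :=
  (∀ S : Finset E, (S : Set E) ⊆ X → S.card = Module.finrank ℝ E + 1 →
      ∀ (φ : E →ₗ[ℝ] ℝ) (c : ℝ), φ ≠ 0 → ¬ (S : Set E) ⊆ {x | φ x = c}) ∧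
  (∀ S : Finset E, (S : Set E) ⊆ X → S.card = Module.finrank ℝ E + 2 →
      ∀ B : Set E, IsQBall Q B → ¬ (S : Set E) ⊆ frontier B)

/-- `K` is a decomposition of the convex hull of `X` into convex polytopes (of all dimensions) with
`0`-skeleton `X`. The faces of a polytope `C` are the nonempty sets `F` with `IsExposed ℝ C F`. -/
structure IsCellDecomposition (X : Set E) (K : Set (Set E)) : Prop where
  finite : K.Finite
  polytope : ∀ C ∈ K, ∃ S : Finset E, S.Nonempty ∧ C = convexHull ℝ (S : Set E)
  face_mem : ∀ C ∈ K, ∀ F : Set E, F.Nonempty → IsExposed ℝ C F → F ∈ K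
  inter_face : ∀ C ∈ K, ∀ C' ∈ K, IsExposed ℝ C (C ∩ C')
  sUnion_eq : ⋃₀ K = convexHull ℝ X
  zero_skeleton : {x : E | {x} ∈ K} = X

/-- A polytope `C` is inscribed in `B`: it is contained in `B` and meets the boundary of `B` exactly
in its vertices. -/
def IsInscribed (C B : Set E) : Prop :=
  C ⊆ B ∧ C ∩ frontier B = C.extremePoints ℝ

/-- `B` is a `Q`-ball in which `C` is inscribed and whose interior contains no point of `X`. -/
def IsEmptyQBall (Q : QuadraticForm ℝ E) (X C B : Set E) : Prop :=
  IsQBall Q B ∧ IsInscribed C B ∧ Disjoint X (interior B)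

/-- `K` is a `Q`-Delaunay decomposition for `X`: a cell decomposition of the convex hull with
`0`-skeleton `X`, each cell of which is inscribed in an empty `Q`-ball, this ball being unique for the
cells of full dimension (a cell of smaller dimension is a face of several of these). -/
structure IsDelaunay (Q : QuadraticForm ℝ E) (X : Set E) (K : Set (Set E)) : Prop where
  isCellDecomposition : IsCellDecomposition X K
  exists_ball : ∀ C ∈ K, ∃ B, IsEmptyQBall Q X C B
  unique_ball : ∀ C ∈ K, (interior C).Nonempty →
    ∀ B B', IsEmptyQBall Q X C B → IsEmptyQBall Q X C B' → B = B'

/-- `K` is the `Q`-Delaunay decomposition for `X`: it is one, and there is no other. -/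
def IsTheDelaunay (Q : QuadraticForm ℝ E) (X : Set E) (K : Set (Set E)) : Prop :=
  IsDelaunay Q X K ∧ ∀ K', IsDelaunay Q X K' → K' = K

/-- The homeomorphism `h : A ≃ₜ A'` is cell-wise for the decompositions `K` of `A` and `K'` of `A'`:
the images of the cells of `K` are exactly the cells of `K'`, and `h` is affine on each cell of `K`. -/
def IsCellwise {A A' : Set E} (K K' : Set (Set E)) (h : A ≃ₜ A') : Prop :=
  (fun C : Set E => {y : E | ∃ x : A, (x : E) ∈ C ∧ (h x : E) = y}) '' K = K' ∧
  ∀ C ∈ K, ∃ f : E →ᵃ[ℝ] E, ∀ x : A, (x : E) ∈ C → (h x : E) = f x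

end Delaunay

/-- The degenerate form `(y, z) ↦ Q (y, 0)`. -/
noncomputable def degenerateForm {m k : ℕ} (Q : QuadraticForm ℝ ((Fin m → ℝ) × (Fin k → ℝ))) :
    QuadraticForm ℝ ((Fin m → ℝ) × (Fin k → ℝ)) :=
  Q.comp ((LinearMap.inl ℝ (Fin m → ℝ) (Fin k → ℝ)).comp
    (LinearMap.fst ℝ (Fin m → ℝ) (Fin k → ℝ)))

theorem degenerateForm_apply {m k : ℕ} (Q : QuadraticForm ℝ ((Fin m → ℝ) × (Fin k → ℝ)))
    (y : Fin m → ℝ) (z : Fin k → ℝ) : degenerateForm Q (y, z) = Q (y, 0) := rfl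

/-- The rescaled limit `(y(0), z'(0))` of a path `t ↦ (y(t), z(t))` defined for `t ≥ 0`; the
derivative is the one-sided one. -/
noncomputable def rescaledLimit {m k : ℕ} (p : ℝ → (Fin m → ℝ) × (Fin k → ℝ)) :
    (Fin m → ℝ) × (Fin k → ℝ) :=
  ((p 0).1, derivWithin (fun t => (p t).2) (Set.Ici 0) 0)

/-! Lift each point `x i` to height `w i = Q (x i)`. A `Q`-ball is `{Q ≤ g}` with `g` affine, so an
empty ball through some of the points is an affine `g` that lies below the heights and touches them
there, that is, a lower face of the lifted configuration. Genericity makes all lower faces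
simplices. Spacelike position gives each lifted point a supporting affine function and makes `Q`
behave like a strictly convex function on convex combinations of the points, even if `Q` is
indefinite. Hence the projected lower faces form the unique Delaunay decomposition
(`IsGenericLift.isTheDelaunay`).

For the degeneration, the map `(y, z) ↦ (y, t z)` sends `(y_i(t), z_i(t)/t)` to `p_i(t)`. Lower
faces are invariant under affine equivalences that keep the heights, so `X_t` may be replaced by
these rescaled points with heights `Q (p_i(t))`. As `t → 0` the points tend to `q_i` and the heights
to the degenerate form at `q_i`. Being a generic lift with given lower faces amounts to finitely
many strict conditions, hence is stable under small perturbations (`eventually_isGenericLift`,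
`eventually_isLowerFace_iff`). Equal lower faces give a cellwise homeomorphism, because both hulls
are parametrised by the same subcomplex of the standard simplex. -/

/-! ### Lower faces of a lifted point configuration. -/

section LowerFaces

variable {ι E : Type*} [Fintype ι] [NormedAddCommGroup E] [NormedSpace ℝ E]

/-- The face of the standard simplex spanned by the vertices in `I`. -/
def simplexFace (I : Finset ι) : Set (ι → ℝ) :=
  {a | a ∈ stdSimplex ℝ ι ∧ ∀ i ∉ I, a i = 0}

/-- Weights are extended by zero to all of `ι`, so that combinations over different index sets can
be compared as vectors. -/
theorem mem_convexHull_image_iff (x : ι → E) (I : Finset ι) (p : E) :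
    p ∈ convexHull ℝ (x '' (I : Set ι)) ↔ ∃ a ∈ simplexFace I, ∑ i, a i • x i = p := by
  classical
  constructor
  · intro hp
    have hsub : convexHull ℝ (x '' (I : Set ι)) ⊆
        (fun a : ι → ℝ => ∑ i, a i • x i) '' simplexFace I := by
      apply convexHull_min
      · rintro _ ⟨i, hi, rfl⟩
        refine ⟨Pi.single i 1, ⟨single_mem_stdSimplex ℝ i, fun j hj => ?_⟩, ?_⟩
        · refine Pi.single_eq_of_ne ?_ _
          rintro rfl
          exact hj hi
        · simp [Pi.single_apply]
      · have hconv : Convex ℝ (simplexFace I) := by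
          intro a ha b hb s t hs ht hst
          refine ⟨convex_stdSimplex ℝ ι ha.1 hb.1 hs ht hst, fun i hi => ?_⟩
          simp [ha.2 i hi, hb.2 i hi]
        have hlin : IsLinearMap ℝ (fun a : ι → ℝ => ∑ i, a i • x i) :=
          ⟨fun a b => by simp [add_smul, Finset.sum_add_distrib],
            fun c a => by simp [Finset.smul_sum, mul_smul]⟩
        exact hconv.is_linear_image hlin
    obtain ⟨a, ha, rfl⟩ := hsub hp
    exact ⟨a, ha, rfl⟩
  · rintro ⟨a, ⟨ha, haI⟩, rfl⟩
    have hsum : ∑ i, a i • x i = ∑ i ∈ I, a i • x i := by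
      symm
      apply Finset.sum_subset (Finset.subset_univ _)
      intro i _ hi
      simp [haI i hi]
    have hone : ∑ i ∈ I, a i = 1 := by
      rw [← ha.2]
      apply Finset.sum_subset (Finset.subset_univ _)
      intro i _ hi
      exact haI i hi
    rw [hsum]
    exact (convex_convexHull ℝ _).sum_mem (fun i _ => ha.1 i) hone
      fun i hi => subset_convexHull ℝ _ ⟨i, hi, rfl⟩

theorem AffineMap.map_stdSimplex_sum {F : Type*} [AddCommGroup F] [Module ℝ F]
    (g : E →ᵃ[ℝ] F) (x : ι → E) {a : ι → ℝ} (ha : ∑ i, a i = 1) :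
    g (∑ i, a i • x i) = ∑ i, a i • g (x i) := by
  have h : ∀ y, g y = g.linear y + g 0 := fun y => congrFun (AffineMap.decomp g) y
  rw [h]
  simp_rw [h (x _), smul_add, Finset.sum_add_distrib, ← Finset.sum_smul, ha, one_smul, map_sum,
    map_smul]

/-- `I` indexes points of a lower face of the lifted configuration `(x i, w i)`: some affine function
bounds the weights from below and agrees with them on `I`. -/
def IsLowerFace (x : ι → E) (w : ι → ℝ) (I : Finset ι) : Prop :=
  ∃ g : E →ᵃ[ℝ] ℝ, (∀ i, g (x i) ≤ w i) ∧ ∀ i ∈ I, g (x i) = w i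

omit [Fintype ι] in
theorem IsLowerFace.mono {x : ι → E} {w : ι → ℝ} {I J : Finset ι} (h : IsLowerFace x w I)
    (hJ : J ⊆ I) : IsLowerFace x w J := by
  obtain ⟨g, h1, h2⟩ := h
  exact ⟨g, h1, fun i hi => h2 i (hJ hi)⟩

theorem isLowerFace_empty (x : ι → E) (w : ι → ℝ) : IsLowerFace x w ∅ := by
  obtain ⟨c, hc⟩ := (Set.finite_range w).bddBelow
  exact ⟨AffineMap.const ℝ E c, fun i => hc ⟨i, rfl⟩, by simp⟩

/-- Tilting an affine lower bound upwards until it touches another weight. -/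
theorem exists_tilt {x : ι → E} {w : ι → ℝ} {g : E →ᵃ[ℝ] ℝ} (hg : ∀ i, g (x i) ≤ w i)
    (h : E →ᵃ[ℝ] ℝ) (hpos : ∃ i, 0 < h (x i)) :
    ∃ s : ℝ, ∃ i, 0 ≤ s ∧ 0 < h (x i) ∧ g (x i) + s * h (x i) = w i ∧
      ∀ j, (g + s • h) (x j) ≤ w j := by
  classical
  -- The smallest ratio is the first contact; points with `h ≤ 0` never obstruct an upward tilt.
  obtain ⟨i, hi, hmin⟩ := Finset.exists_min_image (Finset.univ.filter fun i => 0 < h (x i))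
    (fun i => (w i - g (x i)) / h (x i)) (by simpa [Finset.Nonempty] using hpos)
  rw [Finset.mem_filter] at hi
  refine ⟨(w i - g (x i)) / h (x i), i, div_nonneg (sub_nonneg.2 (hg i)) hi.2.le, hi.2, ?_, ?_⟩
  · rw [div_mul_cancel₀ _ hi.2.ne']
    ring
  · intro j
    simp only [AffineMap.coe_add, AffineMap.coe_smul, Pi.add_apply, Pi.smul_apply, smul_eq_mul]
    rcases lt_or_ge 0 (h (x j)) with hj | hj
    · have := (le_div_iff₀ hj).1 (hmin j (by simp [hj]))
      linarith
    · have := mul_nonpos_of_nonneg_of_nonpos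
        (div_nonneg (sub_nonneg.2 (hg i)) hi.2.le) hj
      linarith [hg j]

/-- A lifted configuration in general position all of whose points are vertices of the lower hull. -/
structure IsGenericLift (x : ι → E) (w : ι → ℝ) : Prop where
  card_le : Module.finrank ℝ E + 1 ≤ Fintype.card ι
  affineIndependent : ∀ T : Finset ι, T.card = Module.finrank ℝ E + 1 →
    AffineIndependent ℝ fun i : T => x i
  exists_ne : ∀ T : Finset ι, T.card = Module.finrank ℝ E + 2 →
    ∀ g : E →ᵃ[ℝ] ℝ, ∃ i ∈ T, g (x i) ≠ w i
  singleton : ∀ i, IsLowerFace x w {i}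

namespace IsGenericLift

variable [FiniteDimensional ℝ E] {x : ι → E} {w : ι → ℝ}

/-- The affine basis formed by `d + 1` of the points. -/
noncomputable def basis (hG : IsGenericLift x w) {T : Finset ι}
    (hT : T.card = Module.finrank ℝ E + 1) : AffineBasis T ℝ E :=
  ⟨fun i => x i, hG.affineIndependent T hT,
    (hG.affineIndependent T hT).affineSpan_eq_top_iff_card_eq_finrank_add_one.2 (by simpa using hT)⟩

theorem basis_apply (hG : IsGenericLift x w) {T : Finset ι}
    (hT : T.card = Module.finrank ℝ E + 1) (i : T) : hG.basis hT i = x i := rfl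

theorem coord_self (hG : IsGenericLift x w) {T : Finset ι}
    (hT : T.card = Module.finrank ℝ E + 1) (i : T) : (hG.basis hT).coord i (x i) = 1 :=
  (hG.basis hT).coord_apply_eq i

theorem coord_ne (hG : IsGenericLift x w) {T : Finset ι}
    (hT : T.card = Module.finrank ℝ E + 1) {i j : T} (h : i ≠ j) :
    (hG.basis hT).coord i (x j) = 0 :=
  (hG.basis hT).coord_apply_ne h

omit [FiniteDimensional ℝ E] in
theorem card_le_of_forall_eq (hG : IsGenericLift x w) {I : Finset ι} {g : E →ᵃ[ℝ] ℝ}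
    (h : ∀ i ∈ I, g (x i) = w i) : I.card ≤ Module.finrank ℝ E + 1 := by
  by_contra! hlt
  obtain ⟨T, hTI, hT⟩ := Finset.exists_subset_card_eq (show Module.finrank ℝ E + 2 ≤ I.card by omega)
  obtain ⟨i, hi, hne⟩ := hG.exists_ne T hT g
  exact hne (h i (hTI hi))

/-- Every lower face is contained in one with `d + 1` points. -/
theorem exists_facet (hG : IsGenericLift x w) {I : Finset ι} (hI : IsLowerFace x w I) :
    ∃ T, I ⊆ T ∧ T.card = Module.finrank ℝ E + 1 ∧ IsLowerFace x w T := by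
  classical
  obtain ⟨J, hJ, hmax⟩ := Finset.exists_max_image
    (Finset.univ.filter fun J : Finset ι => I ⊆ J ∧ IsLowerFace x w J) Finset.card
    ⟨I, by simp [hI]⟩
  simp only [Finset.mem_filter, Finset.mem_univ, true_and] at hJ hmax
  obtain ⟨hIJ, g, hg, hgJ⟩ := hJ
  refine ⟨J, hIJ, ?_, g, hg, hgJ⟩
  by_contra hne
  have hle := hG.card_le_of_forall_eq hgJ
  obtain ⟨T, hJT, -, hT⟩ := Finset.exists_subsuperset_card_eq (Finset.subset_univ J) hle
    (by simpa using hG.card_le)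
  obtain ⟨j, hjT, hjJ⟩ := Finset.exists_mem_notMem_of_card_lt_card
    (show J.card < T.card by omega)
  -- This coordinate vanishes on `J`, so tilting along it keeps all contacts and gains a new one,
  -- against maximality of `J`.
  set h := (hG.basis hT).coord ⟨j, hjT⟩
  obtain ⟨s, i, hs, hi, hsi, hle'⟩ := exists_tilt hg h ⟨j, by
    rw [show h (x j) = 1 from hG.coord_self hT ⟨j, hjT⟩]; exact one_pos⟩
  have hJ0 : ∀ l ∈ J, h (x l) = 0 := by
    intro l hl
    refine hG.coord_ne hT (i := ⟨j, hjT⟩) (j := ⟨l, hJT hl⟩) ?_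
    rintro h'
    rw [Subtype.mk.injEq] at h'
    exact hjJ (h' ▸ hl)
  have hiJ : i ∉ J := fun h' => hi.ne' (hJ0 i h')
  have := hmax (insert i J) ⟨hIJ.trans (Finset.subset_insert _ _), g + s • h, hle', by
    intro l hl
    rcases Finset.mem_insert.1 hl with rfl | hl
    · simpa using hsi
    · simp [hJ0 l hl, hgJ l hl]⟩
  rw [Finset.card_insert_of_notMem hiJ] at this
  omega

/-- The lower faces cover the convex hull. -/
theorem exists_mem_convexHull (hG : IsGenericLift x w) {p : E}
    (hp : p ∈ convexHull ℝ (Set.range x)) :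
    ∃ T : Finset ι, T.card = Module.finrank ℝ E + 1 ∧ IsLowerFace x w T ∧
      p ∈ convexHull ℝ (x '' (T : Set ι)) := by
  classical
  have hch : ∀ T : Finset ι, ∃ g : E →ᵃ[ℝ] ℝ,
      IsLowerFace x w T → (∀ i, g (x i) ≤ w i) ∧ ∀ i ∈ T, g (x i) = w i := by
    intro T
    by_cases hT : IsLowerFace x w T
    · exact ⟨hT.choose, fun _ => hT.choose_spec⟩
    · exact ⟨0, fun h => (hT h).elim⟩
  choose G hGspec using hch
  obtain ⟨T₀, -, hT₀, hT₀l⟩ := hG.exists_facet (isLowerFace_empty x w)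
  -- As in the simplex method, take the facet whose affine function is largest at `p`. If `p` had a
  -- negative coordinate, a pivot across the opposite face would increase this value.
  obtain ⟨T, hT, hmax⟩ := Finset.exists_max_image
    (Finset.univ.filter fun T : Finset ι => T.card = Module.finrank ℝ E + 1 ∧ IsLowerFace x w T)
    (fun T => G T p) ⟨T₀, by simp [hT₀, hT₀l]⟩
  simp only [Finset.mem_filter, Finset.mem_univ, true_and] at hT hmax
  obtain ⟨hT, hTl⟩ := hT
  refine ⟨T, hT, hTl, ?_⟩
  obtain ⟨hg, hgT⟩ := hGspec T hTl
  have hrange : x '' (T : Set ι) = Set.range (hG.basis hT) := by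
    ext y
    simp [basis_apply]
  rw [hrange, AffineBasis.convexHull_eq_nonneg_coord]
  by_contra hneg
  simp only [Set.mem_ofPred_eq, not_forall, not_le] at hneg
  obtain ⟨⟨j, hj⟩, hneg⟩ := hneg
  set h : E →ᵃ[ℝ] ℝ := -(hG.basis hT).coord ⟨j, hj⟩ with hh
  have hhp : 0 < h p := by simpa [hh] using hneg
  have hhj : h (x j) = -1 := by simp [hh, hG.coord_self hT ⟨j, hj⟩]
  have hhT : ∀ l ∈ T, l ≠ j → h (x l) = 0 := by
    intro l hl hlj
    have := hG.coord_ne hT (i := ⟨j, hj⟩) (j := ⟨l, hl⟩) (by simpa using hlj.symm)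
    simp [hh, this]
  have hp' := hp
  rw [← Set.image_univ, ← Finset.coe_univ, mem_convexHull_image_iff] at hp'
  obtain ⟨a, ⟨ha, -⟩, hap⟩ := hp'
  have hpos : ∃ i, 0 < h (x i) := by
    by_contra! hle
    have : h p ≤ 0 := by
      rw [← hap, AffineMap.map_stdSimplex_sum h x ha.2]
      exact Finset.sum_nonpos fun i _ => mul_nonpos_of_nonneg_of_nonpos (ha.1 i) (hle i)
    linarith
  obtain ⟨s, i, hs, hi, hsi, hle⟩ := exists_tilt hg h hpos
  have hiT : i ∉ T := by
    intro hiT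
    by_cases hij : i = j
    · rw [hij, hhj] at hi; linarith
    · rw [hhT i hiT hij] at hi; exact lt_irrefl _ hi
  -- With `s = 0` the function `G T` would touch `d + 2` weights.
  have hspos : 0 < s := by
    refine lt_of_le_of_ne hs ?_
    rintro rfl
    have := hG.card_le_of_forall_eq (I := insert i T) (g := G T) (by
      intro l hl
      rcases Finset.mem_insert.1 hl with rfl | hl
      · simpa using hsi
      · exact hgT l hl)
    rw [Finset.card_insert_of_notMem hiT] at this
    omega
  have hiT' : i ∉ T.erase j := fun h => hiT (Finset.mem_of_mem_erase h)
  have hcard : (insert i (T.erase j)).card = Module.finrank ℝ E + 1 := by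
    rw [Finset.card_insert_of_notMem hiT', Finset.card_erase_of_mem hj]
    omega
  have heq : ∀ l ∈ insert i (T.erase j), (G T + s • h) (x l) = w l := by
    intro l hl
    rcases Finset.mem_insert.1 hl with rfl | hl
    · simpa using hsi
    · rw [Finset.mem_erase] at hl
      simp [hhT l hl.2 hl.1, hgT l hl.2]
  have hlow : IsLowerFace x w (insert i (T.erase j)) := ⟨_, hle, heq⟩
  have hGeq : G (insert i (T.erase j)) = G T + s • h := by
    refine AffineMap.ext_on (hG.basis hcard).tot ?_
    rintro _ ⟨l, rfl⟩
    rw [basis_apply, heq l l.2, (hGspec _ hlow).2 l l.2]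
  have := hmax _ ⟨hcard, hlow⟩
  rw [hGeq] at this
  simp only [AffineMap.coe_add, AffineMap.coe_smul, Pi.add_apply, Pi.smul_apply, smul_eq_mul] at this
  nlinarith [mul_pos hspos hhp]

/-- Every point has at most one representation as a convex combination supported on a lower face. -/
theorem eq_of_sum_eq (hG : IsGenericLift x w) {I J : Finset ι} (hI : IsLowerFace x w I)
    (hJ : IsLowerFace x w J) {a b : ι → ℝ} (ha : a ∈ simplexFace I) (hb : b ∈ simplexFace J)
    (hab : ∑ i, a i • x i = ∑ i, b i • x i) : a = b := by
  classical
  obtain ⟨g, hg, hgI⟩ := hI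
  obtain ⟨g', hg', hgJ⟩ := hJ
  have h1 : ∑ i, a i * w i = g (∑ i, a i • x i) := by
    rw [AffineMap.map_stdSimplex_sum g x ha.1.2]
    refine Finset.sum_congr rfl fun i _ => ?_
    by_cases hi : i ∈ I
    · rw [hgI i hi, smul_eq_mul]
    · simp [ha.2 i hi]
  have h2 : g (∑ i, b i • x i) ≤ ∑ i, b i * w i := by
    rw [AffineMap.map_stdSimplex_sum g x hb.1.2]
    exact Finset.sum_le_sum fun i _ => mul_le_mul_of_nonneg_left (hg i) (hb.1.1 i)
  have h3 : ∑ i, b i * w i = g' (∑ i, b i • x i) := by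
    rw [AffineMap.map_stdSimplex_sum g' x hb.1.2]
    refine Finset.sum_congr rfl fun i _ => ?_
    by_cases hi : i ∈ J
    · rw [hgJ i hi, smul_eq_mul]
    · simp [hb.2 i hi]
  -- Both combinations minimise the height over their common point, so `g'` must touch wherever `a`
  -- has weight.
  have h4 : ∑ i, a i * (w i - g' (x i)) = 0 := by
    apply le_antisymm
    · have : g' (∑ i, a i • x i) = ∑ i, a i * g' (x i) :=
        AffineMap.map_stdSimplex_sum g' x ha.1.2
      simp_rw [mul_sub, Finset.sum_sub_distrib, ← this]
      rw [h1, hab, ← h3]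
      linarith
    · exact Finset.sum_nonneg fun i _ => mul_nonneg (ha.1.1 i) (sub_nonneg.2 (hg' i))
  have h5 : ∀ i, a i ≠ 0 → g' (x i) = w i := by
    intro i hi
    have := (Finset.sum_eq_zero_iff_of_nonneg fun i _ =>
      mul_nonneg (ha.1.1 i) (sub_nonneg.2 (hg' i))).1 h4 i (Finset.mem_univ i)
    rcases mul_eq_zero.1 this with h | h
    · exact (hi h).elim
    · linarith
  -- Both supports lie in the contact set of `g'`, which is affinely independent, so the weights are
  -- barycentric coordinates.
  obtain ⟨T, hsub, hT, -⟩ := hG.exists_facet (I := Finset.univ.filter fun i => g' (x i) = w i)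
    ⟨g', hg', by simp⟩
  have haT : ∀ i ∉ T, a i = 0 := by
    intro i hi
    by_contra hne
    exact hi (hsub (by simp [h5 i hne]))
  have hbT : ∀ i ∉ T, b i = 0 := by
    intro i hi
    by_contra hne
    refine hi (hsub ?_)
    simp only [Finset.mem_filter, Finset.mem_univ, true_and]
    by_cases hiJ : i ∈ J
    · exact hgJ i hiJ
    · exact (hne (hb.2 i hiJ)).elim
  have key : ∀ c : ι → ℝ, ∑ i, c i = 1 → (∀ i ∉ T, c i = 0) → ∀ j : T,
      (hG.basis hT).coord j (∑ i, c i • x i) = c j := by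
    intro c hc hcT j
    rw [AffineMap.map_stdSimplex_sum _ x hc, Finset.sum_eq_single (j : ι)]
    · rw [hG.coord_self hT j, smul_eq_mul, mul_one]
    · intro i _ hij
      by_cases hi : i ∈ T
      · rw [hG.coord_ne hT (i := j) (j := ⟨i, hi⟩) (by
          intro h; exact hij (congrArg Subtype.val h).symm), smul_zero]
      · rw [hcT i hi, zero_smul]
    · simp
  funext i
  by_cases hi : i ∈ T
  · rw [← key a ha.1.2 haT ⟨i, hi⟩, hab, key b hb.1.2 hbT ⟨i, hi⟩]
  · rw [haT i hi, hbT i hi]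

end IsGenericLift

end LowerFaces

/-! ### The projected lower faces form a simplicial complex. -/

section CellComplex

variable {ι E : Type*} [NormedAddCommGroup E] [NormedSpace ℝ E]

/-- The convex hulls of the nonempty lower faces. -/
def lowerCells (x : ι → E) (w : ι → ℝ) : Set (Set E) :=
  {C | ∃ I : Finset ι, I.Nonempty ∧ IsLowerFace x w I ∧ convexHull ℝ (x '' (I : Set ι)) = C}

variable [Fintype ι]

/-- A vanishing convex combination of nonpositive numbers puts weight only on the zeros. -/
theorem mem_convexHull_of_map_eq_zero (x : ι → E) (g : E →ᵃ[ℝ] ℝ) {I : Finset ι}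
    (hg : ∀ i ∈ I, g (x i) ≤ 0) {p : E} (hp : p ∈ convexHull ℝ (x '' (I : Set ι)))
    (hgp : g p = 0) : p ∈ convexHull ℝ (x '' (I.filter fun i => g (x i) = 0 : Finset ι)) := by
  rw [mem_convexHull_image_iff] at hp ⊢
  obtain ⟨a, ha, rfl⟩ := hp
  refine ⟨a, ⟨ha.1, fun i hi => ?_⟩, rfl⟩
  by_cases hiI : i ∈ I
  · rw [AffineMap.map_stdSimplex_sum g x ha.1.2] at hgp
    have hle : ∀ i ∈ Finset.univ, a i • g (x i) ≤ 0 := by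
      intro j _
      by_cases hj : j ∈ I
      · exact mul_nonpos_of_nonneg_of_nonpos (ha.1.1 j) (hg j hj)
      · simp [ha.2 j hj]
    have := (Finset.sum_eq_zero_iff_of_nonpos hle).1 hgp i (Finset.mem_univ i)
    rcases mul_eq_zero.1 this with h | h
    · exact h
    · exact (hi (by simp [hiI, h])).elim
  · exact ha.2 i hiI

omit [Fintype ι] in
theorem AffineMap.nonpos_of_mem_convexHull (g : E →ᵃ[ℝ] ℝ) {A : Set E} (hA : ∀ y ∈ A, g y ≤ 0)
    {p : E} (hp : p ∈ convexHull ℝ A) : g p ≤ 0 := by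
  have : convexHull ℝ A ⊆ g ⁻¹' Set.Iic 0 :=
    convexHull_min hA ((convex_Iic (0 : ℝ)).affine_preimage g)
  exact this hp

variable [FiniteDimensional ℝ E]

omit [Fintype ι] in
theorem AffineMap.isExposed_of_nonpos (g : E →ᵃ[ℝ] ℝ) {A : Set E} (hA : ∀ y ∈ A, g y ≤ 0) :
    IsExposed ℝ A {p ∈ A | g p = 0} := by
  rintro ⟨q, hq, hq0⟩
  have h : ∀ y, g y = g.linear y + g 0 := fun y => congrFun (AffineMap.decomp g) y
  refine ⟨LinearMap.toContinuousLinearMap g.linear, ?_⟩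
  ext p
  simp only [Set.mem_sep_iff, LinearMap.coe_toContinuousLinearMap', and_congr_right_iff]
  intro hp
  constructor
  · intro hp0 y hy
    linarith [hA y hy, h y, h p]
  · intro hmax
    linarith [hA p hp, hmax q hq, h q, h p]

namespace IsGenericLift

variable {x : ι → E} {w : ι → ℝ}

theorem isExposed_convexHull (hG : IsGenericLift x w) {I J : Finset ι} (hI : IsLowerFace x w I)
    (hJ : J ⊆ I) :
    IsExposed ℝ (convexHull ℝ (x '' (I : Set ι))) (convexHull ℝ (x '' (J : Set ι))) := by
  classical
  obtain ⟨T, hIT, hT, -⟩ := hG.exists_facet hI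
  -- This exposing functional is `0` on the vertices in `J` and `-1` on the other vertices of `T`.
  set g : E →ᵃ[ℝ] ℝ := -∑ i ∈ Finset.univ.filter fun i : T => (i : ι) ∉ J, (hG.basis hT).coord i
    with hg
  have hval : ∀ i ∈ T, g (x i) = if i ∈ J then 0 else -1 := by
    intro i hi
    have hev : ∀ S : Finset T, (∑ j ∈ S, (hG.basis hT).coord j) (x i) =
        ∑ j ∈ S, (hG.basis hT).coord j (x i) := by
      intro S
      induction S using Finset.induction_on with
      | empty => simp
      | insert j S hj ih => simp [Finset.sum_insert hj, ih]
    rw [hg, AffineMap.coe_neg, Pi.neg_apply, hev]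
    split_ifs with hiJ
    · rw [Finset.sum_eq_zero, neg_zero]
      intro j hj
      refine hG.coord_ne hT (i := j) (j := ⟨i, hi⟩) ?_
      rintro rfl
      simp [hiJ] at hj
    · rw [Finset.sum_eq_single ⟨i, hi⟩, hG.coord_self hT ⟨i, hi⟩]
      · intro j _ hj
        exact hG.coord_ne hT (j := ⟨i, hi⟩) hj
      · simp [hiJ]
  have hle : ∀ i ∈ I, g (x i) ≤ 0 := by
    intro i hi
    rw [hval i (hIT hi)]
    split_ifs <;> norm_num
  have heq : convexHull ℝ (x '' (J : Set ι)) =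
      {p ∈ convexHull ℝ (x '' (I : Set ι)) | g p = 0} := by
    apply Set.Subset.antisymm
    · apply convexHull_min
      · rintro _ ⟨i, hi, rfl⟩
        refine ⟨subset_convexHull ℝ _ ⟨i, hJ hi, rfl⟩, ?_⟩
        rw [hval i (hIT (hJ hi)), if_pos (by exact hi)]
      · exact (convex_convexHull ℝ _).inter ((convex_singleton (0 : ℝ)).affine_preimage g)
    · rintro p ⟨hp, hp0⟩
      refine convexHull_mono (Set.image_mono ?_) (mem_convexHull_of_map_eq_zero x g hle hp hp0)
      intro i hi
      simp only [Finset.coe_filter, Set.mem_ofPred_eq] at hi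
      by_contra hiJ
      have := hval i (hIT hi.1)
      rw [if_neg (by simpa using hiJ), hi.2] at this
      norm_num at this
  rw [heq]
  refine AffineMap.isExposed_of_nonpos g fun y hy => ?_
  refine AffineMap.nonpos_of_mem_convexHull g ?_ hy
  rintro _ ⟨i, hi, rfl⟩
  exact hle i hi

/-- Since `{i}` is itself a lower face, uniqueness of representations applies to `x i`. -/
theorem apply_mem_convexHull_iff (hG : IsGenericLift x w) {I : Finset ι}
    (hI : IsLowerFace x w I) {i : ι} : x i ∈ convexHull ℝ (x '' (I : Set ι)) ↔ i ∈ I := by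
  classical
  refine ⟨fun h => ?_, fun h => subset_convexHull ℝ _ ⟨i, h, rfl⟩⟩
  obtain ⟨a, ha, hax⟩ := (mem_convexHull_image_iff x I _).1 h
  obtain ⟨b, hb, hbx⟩ := (mem_convexHull_image_iff x {i} (x i)).1
    (subset_convexHull ℝ _ ⟨i, by simp, rfl⟩)
  have hab := hG.eq_of_sum_eq hI (hG.singleton i) ha hb (hax.trans hbx.symm)
  by_contra hi
  have h0 : b i = 0 := hab ▸ ha.2 i hi
  have h1 := hb.1.2
  rw [Finset.sum_eq_single i (fun j _ hj => hb.2 j (by simpa using hj)) (by simp), h0] at h1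
  exact zero_ne_one h1

/-- A cell could a priori be the hull of several index sets; but every configuration point in it is
a vertex, so `I` lies in the index set of the cell. -/
theorem convexHull_mem_lowerCells_iff (hG : IsGenericLift x w) {I : Finset ι} :
    convexHull ℝ (x '' (I : Set ι)) ∈ lowerCells x w ↔ I.Nonempty ∧ IsLowerFace x w I := by
  constructor
  · rintro ⟨J, hJ, hJl, hJI⟩
    refine ⟨?_, hJl.mono fun i hi => ?_⟩
    · have : (convexHull ℝ (x '' (I : Set ι))).Nonempty := by
        rw [← hJI]
        simpa using hJ
      simpa using this
    · rw [← hG.apply_mem_convexHull_iff hJl, hJI]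
      exact subset_convexHull ℝ _ ⟨i, hi, rfl⟩
  · rintro ⟨h1, h2⟩
    exact ⟨I, h1, h2, rfl⟩

theorem convexHull_inter [DecidableEq ι] (hG : IsGenericLift x w) {I J : Finset ι}
    (hI : IsLowerFace x w I) (hJ : IsLowerFace x w J) :
    convexHull ℝ (x '' (I : Set ι)) ∩ convexHull ℝ (x '' (J : Set ι)) =
      convexHull ℝ (x '' ((I ∩ J : Finset ι) : Set ι)) := by
  apply Set.Subset.antisymm
  · rintro p ⟨hp, hp'⟩
    rw [mem_convexHull_image_iff] at hp hp' ⊢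
    obtain ⟨a, ha, rfl⟩ := hp
    obtain ⟨b, hb, hbx⟩ := hp'
    obtain rfl := hG.eq_of_sum_eq hI hJ ha hb hbx.symm
    refine ⟨a, ⟨ha.1, fun i hi => ?_⟩, rfl⟩
    by_cases h : i ∈ I
    · exact hb.2 i fun h' => hi (Finset.mem_inter.2 ⟨h, h'⟩)
    · exact ha.2 i h
  · exact Set.subset_inter (convexHull_mono (Set.image_mono (by simp)))
      (convexHull_mono (Set.image_mono (by simp)))

theorem isCellDecomposition (hG : IsGenericLift x w) :
    IsCellDecomposition (Set.range x) (lowerCells x w) where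
  finite := by
    refine (Set.finite_range fun I : Finset ι => convexHull ℝ (x '' (I : Set ι))).subset ?_
    rintro C ⟨I, -, -, rfl⟩
    exact ⟨I, rfl⟩
  polytope := by
    classical
    rintro C ⟨I, hI, -, rfl⟩
    exact ⟨I.image x, hI.image x, by rw [Finset.coe_image]⟩
  face_mem := by
    rintro C ⟨I, hI, hIl, rfl⟩ F hF hFe
    obtain ⟨l, hl⟩ := hFe hF
    obtain ⟨p, hp⟩ := hF
    have hp' := hp
    rw [hl] at hp'
    -- Normalised so that `g ≤ 0` on the cell, with zero set exactly the face `F`.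
    set g : E →ᵃ[ℝ] ℝ := (l : E →ₗ[ℝ] ℝ).toAffineMap - AffineMap.const ℝ E (l p) with hg
    have hgv : ∀ y, g y = l y - l p := fun y => rfl
    have hle : ∀ i ∈ I, g (x i) ≤ 0 := by
      intro i hi
      rw [hgv, sub_nonpos]
      exact hp'.2 _ (subset_convexHull ℝ _ ⟨i, hi, rfl⟩)
    have hFeq : F = convexHull ℝ (x '' (I.filter fun i => g (x i) = 0 : Finset ι)) := by
      apply Set.Subset.antisymm
      · intro q hq
        rw [hl] at hq
        refine mem_convexHull_of_map_eq_zero x g hle hq.1 ?_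
        rw [hgv]
        linarith [hq.2 p hp'.1, hp'.2 q hq.1]
      · apply convexHull_min
        · rintro _ ⟨i, hi, rfl⟩
          simp only [Finset.coe_filter, Set.mem_ofPred_eq, hgv] at hi
          rw [hl]
          refine ⟨subset_convexHull ℝ _ ⟨i, hi.1, rfl⟩, fun y hy => ?_⟩
          linarith [hp'.2 y hy, hi.2]
        · exact hFe.convex (convex_convexHull ℝ _)
    refine ⟨_, ?_, hIl.mono (Finset.filter_subset _ _), hFeq.symm⟩
    rw [hFeq] at hp
    exact Finset.coe_nonempty.1 (Set.image_nonempty.1 (convexHull_nonempty_iff.1 ⟨p, hp⟩))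
  inter_face := by
    classical
    rintro _ ⟨I, -, hIl, rfl⟩ _ ⟨J, -, hJl, rfl⟩
    rw [hG.convexHull_inter hIl hJl]
    exact hG.isExposed_convexHull hIl Finset.inter_subset_left
  sUnion_eq := by
    apply Set.Subset.antisymm
    · apply Set.sUnion_subset
      rintro C ⟨I, -, -, rfl⟩
      exact convexHull_mono (Set.image_subset_range _ _)
    · intro p hp
      obtain ⟨T, hT, hTl, hpT⟩ := hG.exists_mem_convexHull hp
      exact ⟨_, ⟨T, Finset.card_pos.1 (by omega), hTl, rfl⟩, hpT⟩
  zero_skeleton := by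
    ext y
    constructor
    · rintro ⟨I, -, -, hIy⟩
      have hy := convexHull_eq_singleton.1 hIy
      obtain ⟨i, -, rfl⟩ : y ∈ x '' (I : Set ι) := by rw [hy]; rfl
      exact ⟨i, rfl⟩
    · rintro ⟨i, rfl⟩
      exact ⟨{i}, by simp, hG.singleton i, by simp⟩

theorem extremePoints_convexHull (hG : IsGenericLift x w) {I : Finset ι}
    (hI : IsLowerFace x w I) :
    (convexHull ℝ (x '' (I : Set ι))).extremePoints ℝ = x '' (I : Set ι) := by
  apply Set.Subset.antisymm extremePoints_convexHull_subset
  rintro _ ⟨i, hi, rfl⟩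
  apply exposedPoints_subset_extremePoints
  rw [mem_exposedPoints_iff_exposed_singleton]
  have := hG.isExposed_convexHull hI (Finset.singleton_subset_iff.2 hi)
  simpa using this

end IsGenericLift

end CellComplex

/-! ### Cellwise homeomorphisms between hulls with the same lower faces. -/

section Homeomorph

variable {ι E : Type*} [Fintype ι] [NormedAddCommGroup E] [NormedSpace ℝ E]

/-- The subcomplex of the standard simplex formed by the lower faces. -/
def lowerComplex (x : ι → E) (w : ι → ℝ) : Set (ι → ℝ) :=
  ⋃ I ∈ {I : Finset ι | IsLowerFace x w I}, simplexFace I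

omit [NormedAddCommGroup E] [NormedSpace ℝ E] in
theorem isCompact_simplexFace (I : Finset ι) : IsCompact (simplexFace I) := by
  have : simplexFace I = stdSimplex ℝ ι ∩ ⋂ i ∈ {i | i ∉ I}, {a : ι → ℝ | a i = 0} := by
    ext a
    simp [simplexFace]
  rw [this]
  exact (isCompact_stdSimplex ℝ ι).inter_right
    (isClosed_biInter fun i _ => isClosed_eq (continuous_apply i) continuous_const)

theorem isCompact_lowerComplex (x : ι → E) (w : ι → ℝ) : IsCompact (lowerComplex x w) :=
  (Set.toFinite _).isCompact_biUnion fun I _ => isCompact_simplexFace I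

namespace IsGenericLift

variable [FiniteDimensional ℝ E] {x : ι → E} {w : ι → ℝ}

/-- The parametrisation of the convex hull by the complex of lower faces. -/
noncomputable def homeo (hG : IsGenericLift x w) :
    lowerComplex x w ≃ₜ convexHull ℝ (Set.range x) :=
  haveI : CompactSpace (lowerComplex x w) := isCompact_iff_compactSpace.1 (isCompact_lowerComplex x w)
  Continuous.homeoOfEquivCompactToT2
    (f := Equiv.ofBijective
      (fun a : lowerComplex x w => (⟨∑ i, (a : ι → ℝ) i • x i, by
        obtain ⟨I, -, ha⟩ := Set.mem_iUnion₂.1 a.2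
        exact convexHull_mono (Set.image_subset_range _ _)
          ((mem_convexHull_image_iff x I _).2 ⟨a, ha, rfl⟩)⟩ : convexHull ℝ (Set.range x)))
      ⟨by
        rintro ⟨a, ha⟩ ⟨b, hb⟩ hab
        obtain ⟨I, hI, haI⟩ := Set.mem_iUnion₂.1 ha
        obtain ⟨J, hJ, hbJ⟩ := Set.mem_iUnion₂.1 hb
        exact Subtype.ext (hG.eq_of_sum_eq hI hJ haI hbJ (congrArg Subtype.val hab)), by
        rintro ⟨p, hp⟩
        obtain ⟨T, -, hTl, hpT⟩ := hG.exists_mem_convexHull hp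
        obtain ⟨a, ha, rfl⟩ := (mem_convexHull_image_iff x T _).1 hpT
        exact ⟨⟨a, Set.mem_iUnion₂.2 ⟨T, hTl, ha⟩⟩, rfl⟩⟩)
    (by
      refine Continuous.subtype_mk ?_ _
      exact continuous_finsetSum _ fun i _ =>
        ((continuous_apply i).comp continuous_subtype_val).smul continuous_const)

variable {x' : ι → E} {w' : ι → ℝ}

/-- Two generic lifts with the same lower faces have cellwise homeomorphic convex hulls. -/
theorem exists_homeomorph (hG : IsGenericLift x w) (hG' : IsGenericLift x' w')
    (h : ∀ I, IsLowerFace x w I ↔ IsLowerFace x' w' I) :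
    ∃ f : convexHull ℝ (Set.range x) ≃ₜ convexHull ℝ (Set.range x'),
      IsCellwise (lowerCells x w) (lowerCells x' w') f ∧
      ∀ i (hi : x i ∈ convexHull ℝ (Set.range x)), (f ⟨x i, hi⟩ : E) = x' i := by
  classical
  have hc : lowerComplex x w = lowerComplex x' w' := by simp [lowerComplex, h]
  set f := (hG.homeo.symm.trans (Homeomorph.setCongr hc)).trans hG'.homeo with hf
  have hfa : ∀ I, IsLowerFace x w I → ∀ a ∈ simplexFace I,
      ∀ hp : ∑ i, a i • x i ∈ convexHull ℝ (Set.range x),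
      (f ⟨∑ i, a i • x i, hp⟩ : E) = ∑ i, a i • x' i := by
    intro I hI a ha hp
    have : (⟨∑ i, a i • x i, hp⟩ : convexHull ℝ (Set.range x)) =
        hG.homeo ⟨a, Set.mem_iUnion₂.2 ⟨I, hI, ha⟩⟩ := Subtype.ext rfl
    rw [this]
    simp only [hf, Homeomorph.trans_apply, Homeomorph.symm_apply_apply]
    rfl
  have himage : ∀ I, IsLowerFace x w I →
      {y : E | ∃ p : convexHull ℝ (Set.range x),
        (p : E) ∈ convexHull ℝ (x '' (I : Set ι)) ∧ (f p : E) = y} =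
      convexHull ℝ (x' '' (I : Set ι)) := by
    intro I hI
    ext y
    rw [mem_convexHull_image_iff]
    constructor
    · rintro ⟨⟨p, hp⟩, hpI, rfl⟩
      obtain ⟨a, ha, rfl⟩ := (mem_convexHull_image_iff x I _).1 hpI
      exact ⟨a, ha, (hfa I hI a ha hp).symm⟩
    · rintro ⟨a, ha, rfl⟩
      have hp := (mem_convexHull_image_iff x I _).2 ⟨a, ha, rfl⟩
      exact ⟨⟨_, convexHull_mono (Set.image_subset_range _ _) hp⟩, hp, hfa I hI a ha _⟩
  refine ⟨f, ⟨?_, ?_⟩, ?_⟩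
  · ext C
    constructor
    · rintro ⟨_, ⟨I, hI, hIl, rfl⟩, rfl⟩
      exact ⟨I, hI, (h I).1 hIl, (himage I hIl).symm⟩
    · rintro ⟨I, hI, hIl, rfl⟩
      exact ⟨_, ⟨I, hI, (h I).2 hIl, rfl⟩, himage I ((h I).2 hIl)⟩
  · rintro _ ⟨I, -, hIl, rfl⟩
    obtain ⟨T, hIT, hT, -⟩ := hG.exists_facet hIl
    -- The affine map sending the vertices of a facet containing `I` to the corresponding `x' i`.
    set F : E →ᵃ[ℝ] E :=
      ((Fintype.linearCombination ℝ fun i : T => x' i).toAffineMap).comp (hG.basis hT).coords with hF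
    have hFx : ∀ i ∈ T, F (x i) = x' i := by
      intro i hi
      have : F (x i) = ∑ j : T, (hG.basis hT).coord j (x i) • x' j := rfl
      rw [this, Finset.sum_eq_single ⟨i, hi⟩, hG.coord_self hT ⟨i, hi⟩, one_smul]
      · intro j _ hj
        rw [hG.coord_ne hT (j := ⟨i, hi⟩) hj, zero_smul]
      · simp
    refine ⟨F, ?_⟩
    rintro ⟨p, hp⟩ hpI
    obtain ⟨a, ha, rfl⟩ := (mem_convexHull_image_iff x I _).1 hpI
    rw [hfa I hIl a ha hp, AffineMap.map_stdSimplex_sum F x ha.1.2]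
    refine Finset.sum_congr rfl fun i _ => ?_
    by_cases hi : i ∈ I
    · rw [hFx i (hIT hi)]
    · rw [ha.2 i hi, zero_smul, zero_smul]
  · intro i hi
    have hs : (Pi.single i 1 : ι → ℝ) ∈ simplexFace {i} := by
      refine ⟨single_mem_stdSimplex ℝ i, fun j hj => Pi.single_eq_of_ne ?_ _⟩
      simpa using hj
    have hsum : ∀ y : ι → E, ∑ j, (Pi.single i 1 : ι → ℝ) j • y j = y i := by
      intro y
      simp [Pi.single_apply]
    have := hfa {i} (hG.singleton i) _ hs (by rwa [hsum])
    simpa only [hsum] using this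

end IsGenericLift

end Homeomorph

/-! ### Interior and boundary of a `Q`-ball. -/

section QBalls

variable {E : Type*} [NormedAddCommGroup E] [NormedSpace ℝ E] [FiniteDimensional ℝ E]

theorem QuadraticForm.continuous_of_finiteDimensional (Q : QuadraticForm ℝ E) : Continuous Q := by
  have h : (Q : E → ℝ) = fun y =>
      (QuadraticMap.associated (R := ℝ) Q).toContinuousBilinearMap y y := by
    funext y
    simp [QuadraticMap.associated_eq_self_apply]
  rw [h]
  fun_prop

/-- From a point of equality move by `± s v`: the first-order terms cancel in the sum and `s² Q v >
0` remains, so one of the two moves leaves the ball. Without a positive vector this fails, as for `Q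
= 0`, `φ = 0`, `D = 0`. -/
theorem interior_qBall (Q : QuadraticForm ℝ E) (hv : ∃ v, 0 < Q v) (φ : E →ₗ[ℝ] ℝ) (D : ℝ) :
    interior (qBall Q φ D) = {y | Q y < φ y + D} := by
  have hQ := Q.continuous_of_finiteDimensional
  have hφ := φ.continuous_of_finiteDimensional
  apply Set.Subset.antisymm
  · intro y hy
    by_contra hlt
    have hyQ : Q y = φ y + D := le_antisymm (interior_subset hy : y ∈ qBall Q φ D) (not_lt.1 hlt)
    obtain ⟨v, hv⟩ := hv
    have hc : Continuous fun s : ℝ => y + s • v := by fun_prop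
    have hnear : ∀ᶠ s in 𝓝 (0 : ℝ), y + s • v ∈ qBall Q φ D := by
      refine hc.continuousAt.eventually_mem ?_
      simpa using mem_interior_iff_mem_nhds.1 hy
    obtain ⟨ε, hε, hball⟩ := Metric.eventually_nhds_iff.1 hnear
    have hexp : ∀ s : ℝ, Q (y + s • v) = Q y + s * s * Q v + s * QuadraticMap.polar Q y v := by
      intro s
      rw [QuadraticMap.map_add Q, QuadraticMap.map_smul, QuadraticMap.polar_smul_right]
      simp
    have h1 : y + (ε / 2) • v ∈ qBall Q φ D :=
      hball (by rw [Real.dist_eq, sub_zero, abs_of_pos (by linarith)]; linarith)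
    have h2 : y + (-(ε / 2)) • v ∈ qBall Q φ D :=
      hball (by rw [Real.dist_eq, sub_zero, abs_neg, abs_of_pos (by linarith)]; linarith)
    simp only [qBall, Set.mem_ofPred_eq, hexp, map_add, map_smul, smul_eq_mul] at h1 h2
    have : 0 < ε / 2 * (ε / 2) * Q v := by positivity
    linarith
  · exact interior_maximal (fun y (hy : Q y < φ y + D) => hy.le)
      (isOpen_lt hQ (hφ.add continuous_const))

theorem frontier_qBall (Q : QuadraticForm ℝ E) (hv : ∃ v, 0 < Q v) (φ : E →ₗ[ℝ] ℝ) (D : ℝ) :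
    frontier (qBall Q φ D) = {y | Q y = φ y + D} := by
  have hQ := Q.continuous_of_finiteDimensional
  have hφ := φ.continuous_of_finiteDimensional
  have hclosed : IsClosed (qBall Q φ D) := isClosed_le hQ (hφ.add continuous_const)
  rw [hclosed.frontier_eq, interior_qBall Q hv]
  ext y
  simp only [qBall, Set.mem_sdiff, Set.mem_ofPred_eq, not_lt]
  exact le_antisymm_iff.symm

end QBalls

/-! ### Spacelike and generic position in terms of lifts. -/

section Position

variable {ι E : Type*} [Fintype ι] [NormedAddCommGroup E] [NormedSpace ℝ E]

omit [Fintype ι] in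
-- The tangent function of `Q` at `x i` is `g y = Q y - Q (y - x i)`, which lies below `Q` at all
-- other points of a spacelike set.
theorem isLowerFace_singleton_of_spacelike (Q : QuadraticForm ℝ E) {x : ι → E}
    (hsp : SpacelikePosition Q (Set.range x)) (i : ι) :
    IsLowerFace x (fun i => Q (x i)) {i} := by
  set g : E →ᵃ[ℝ] ℝ := (QuadraticMap.polarBilin Q (x i)).toAffineMap - AffineMap.const ℝ E (Q (x i))
  have hg : ∀ y, g y = Q y - Q (y - x i) := by
    intro y
    have h1 : g y = QuadraticMap.polar Q (x i) y - Q (x i) := rfl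
    have h2 := QuadraticMap.map_add Q (x i) (y - x i)
    rw [add_sub_cancel, QuadraticMap.polar_sub_right, QuadraticMap.polar_self] at h2
    rw [h1]
    simp only [nsmul_eq_mul, Nat.cast_ofNat] at h2
    linarith
  refine ⟨g, fun j => ?_, fun j hj => ?_⟩
  · rw [hg]
    by_cases h : x j = x i
    · simp [h]
    · linarith [hsp (x j) ⟨j, rfl⟩ (x i) ⟨i, rfl⟩ h]
  · rw [Finset.mem_singleton.1 hj, hg]
    simp

omit [Fintype ι] in
theorem affineIndependent_of_forall_not_subset_hyperplane {x : ι → E} {T : Finset ι}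
    (hT : T.card = Module.finrank ℝ E + 1)
    (h : ∀ (φ : E →ₗ[ℝ] ℝ) (c : ℝ), φ ≠ 0 → ∃ i ∈ T, φ (x i) ≠ c) :
    AffineIndependent ℝ fun i : T => x i := by
  rw [affineIndependent_iff_le_finrank_vectorSpan ℝ _ (n := Module.finrank ℝ E) (by simpa using hT)]
  by_contra hlt
  have hlt' : vectorSpan ℝ (Set.range fun i : T => x i) < ⊤ := by
    rw [lt_top_iff_ne_top]
    intro htop
    rw [htop, finrank_top] at hlt
    exact hlt le_rfl
  obtain ⟨φ, hφ, hle⟩ := Submodule.exists_le_ker_of_lt_top _ hlt'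
  obtain ⟨j, hj⟩ : T.Nonempty := Finset.card_pos.1 (by omega)
  obtain ⟨i, hi, hne⟩ := h φ (φ (x j)) hφ
  apply hne
  have := hle (vsub_mem_vectorSpan ℝ (Set.mem_range_self (⟨i, hi⟩ : T))
    (Set.mem_range_self (⟨j, hj⟩ : T)))
  rw [LinearMap.mem_ker, vsub_eq_sub, map_sub, sub_eq_zero] at this
  exact this

variable [FiniteDimensional ℝ E]

theorem isGenericLift_of_genericPosition (Q : QuadraticForm ℝ E) (hv : ∃ v, 0 < Q v) {x : ι → E}
    (hx : Function.Injective x) (hcard : Module.finrank ℝ E + 1 ≤ Fintype.card ι)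
    (hsp : SpacelikePosition Q (Set.range x)) (hgen : GenericPosition Q (Set.range x)) :
    IsGenericLift x fun i => Q (x i) where
  card_le := hcard
  affineIndependent := by
    classical
    intro T hT
    refine affineIndependent_of_forall_not_subset_hyperplane hT fun φ c hφ => ?_
    have := hgen.1 (T.image x) (by simp) (by rw [Finset.card_image_of_injective _ hx, hT]) φ c hφ
    simpa [Set.subset_def] using this
  exists_ne := by
    classical
    intro T hT g
    have := hgen.2 (T.image x) (by simp) (by rw [Finset.card_image_of_injective _ hx, hT]) _
      ⟨g.linear, g 0, rfl⟩
    rw [frontier_qBall Q hv] at this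
    by_contra! hall
    apply this
    rw [Finset.coe_image]
    rintro _ ⟨i, hi, rfl⟩
    have h : g (x i) = g.linear (x i) + g 0 := congrFun (AffineMap.decomp g) (x i)
    exact (hall i hi).symm.trans h
  singleton := isLowerFace_singleton_of_spacelike Q hsp

/-- Used at time `t`, where genericity is inherited from stability of the lift. -/
theorem IsGenericLift.genericPosition {Q : QuadraticForm ℝ E} (hv : ∃ v, 0 < Q v) {x : ι → E}
    (hx : Function.Injective x) (hG : IsGenericLift x fun i => Q (x i)) :
    GenericPosition Q (Set.range x) := by
  classical
  constructor
  · intro S hS hcard φ c hφ hsub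
    rw [← Set.image_univ, Finset.subset_set_image_iff] at hS
    obtain ⟨T, -, rfl⟩ := hS
    rw [Finset.card_image_of_injective _ hx] at hcard
    have heq : φ.toAffineMap = AffineMap.const ℝ E c := by
      refine AffineMap.ext_on (hG.basis hcard).tot ?_
      rintro _ ⟨i, rfl⟩
      exact hsub (by simpa using ⟨(i : ι), i.2, rfl⟩)
    apply hφ
    have := congrArg AffineMap.linear heq
    simpa using this
  · rintro S hS hcard _ ⟨φ, D, rfl⟩ hsub
    rw [← Set.image_univ, Finset.subset_set_image_iff] at hS
    obtain ⟨T, -, rfl⟩ := hS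
    rw [Finset.card_image_of_injective _ hx] at hcard
    obtain ⟨i, hi, hne⟩ := hG.exists_ne T hcard (φ.toAffineMap + AffineMap.const ℝ E D)
    rw [frontier_qBall Q hv] at hsub
    exact hne (hsub (by simpa using ⟨i, hi, rfl⟩) : Q (x i) = φ (x i) + D).symm

end Position

/-! ### Existence and uniqueness of the Delaunay decomposition. -/

section DelaunayExistence

variable {ι E : Type*} [Fintype ι] [NormedAddCommGroup E] [NormedSpace ℝ E]

/-- The convexity defect of `Q` involves only squared distances between the points, which is why
spacelike position can replace positivity of `Q`. -/
theorem sum_mul_sub_map_sum (Q : QuadraticForm ℝ E) (x : ι → E) {a : ι → ℝ} (ha : ∑ i, a i = 1) :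
    2 * (∑ i, a i * Q (x i) - Q (∑ i, a i • x i)) = ∑ i, ∑ j, a i * a j * Q (x i - x j) := by
  set B := QuadraticMap.associated (R := ℝ) Q with hB
  have hBQ : ∀ y, Q y = B y y := fun y => (QuadraticMap.associated_eq_self_apply ℝ Q y).symm
  have hsymm : ∀ y z, B y z = B z y := fun y z =>
    QuadraticMap.associated_isSymm ℝ Q y z
  have h1 : Q (∑ i, a i • x i) = ∑ i, ∑ j, a i * a j * B (x i) (x j) := by
    rw [hBQ]
    simp only [map_sum, LinearMap.sum_apply, map_smul, LinearMap.smul_apply, smul_eq_mul,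
      Finset.mul_sum]
    rw [Finset.sum_comm]
    refine Finset.sum_congr rfl fun i _ => Finset.sum_congr rfl fun j _ => by ring
  have h2 : ∀ i j, a i * a j * Q (x i - x j) =
      a i * Q (x i) * a j - 2 * (a i * a j * B (x i) (x j)) + a i * (a j * Q (x j)) := by
    intro i j
    rw [hBQ (x i - x j), hBQ (x i), hBQ (x j)]
    simp only [map_sub, LinearMap.sub_apply]
    rw [hsymm (x j) (x i)]
    ring
  simp_rw [h2, Finset.sum_add_distrib, Finset.sum_sub_distrib, ← Finset.mul_sum, ha,
    ← Finset.sum_mul, ha, h1]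
  ring

theorem map_sum_le_of_spacelike (Q : QuadraticForm ℝ E) {x : ι → E}
    (hsp : SpacelikePosition Q (Set.range x)) {a : ι → ℝ} (ha : a ∈ stdSimplex ℝ ι) :
    Q (∑ i, a i • x i) ≤ ∑ i, a i * Q (x i) := by
  have h := sum_mul_sub_map_sum Q x ha.2
  have : 0 ≤ ∑ i, ∑ j, a i * a j * Q (x i - x j) := by
    refine Finset.sum_nonneg fun i _ => Finset.sum_nonneg fun j _ =>
      mul_nonneg (mul_nonneg (ha.1 i) (ha.1 j)) ?_
    by_cases hij : x i = x j
    · simp [hij]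
    · exact (hsp _ ⟨i, rfl⟩ _ ⟨j, rfl⟩ hij).le
  linarith

/-- Zero defect forces every product of weights at distinct points to vanish. Hence a cell meets its
sphere only in vertices. -/
theorem exists_eq_of_map_sum_eq (Q : QuadraticForm ℝ E) {x : ι → E}
    (hsp : SpacelikePosition Q (Set.range x)) {I : Finset ι} {a : ι → ℝ} (ha : a ∈ simplexFace I)
    (heq : Q (∑ i, a i • x i) = ∑ i, a i * Q (x i)) :
    ∃ i ∈ I, x i = ∑ j, a j • x j := by
  have h := sum_mul_sub_map_sum Q x ha.1.2
  rw [heq, sub_self, mul_zero] at h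
  have hnn : ∀ i j, 0 ≤ a i * a j * Q (x i - x j) := by
    intro i j
    refine mul_nonneg (mul_nonneg (ha.1.1 i) (ha.1.1 j)) ?_
    by_cases hij : x i = x j
    · simp [hij]
    · exact (hsp _ ⟨i, rfl⟩ _ ⟨j, rfl⟩ hij).le
  obtain ⟨i, hi⟩ : ∃ i, a i ≠ 0 := by
    by_contra! h0
    have := ha.1.2
    simp [h0] at this
  refine ⟨i, by_contra fun hiI => hi (ha.2 i hiI), ?_⟩
  have hterm : ∀ j, a j • x j = a j • x i := by
    intro j
    by_cases hij : x j = x i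
    · rw [hij]
    · have h1 := (Finset.sum_eq_zero_iff_of_nonneg fun i _ =>
        Finset.sum_nonneg fun j _ => hnn i j).1 h.symm i (Finset.mem_univ i)
      have h2 := (Finset.sum_eq_zero_iff_of_nonneg fun j _ => hnn i j).1 h1 j (Finset.mem_univ j)
      have h3 := hsp _ ⟨i, rfl⟩ _ ⟨j, rfl⟩ (Ne.symm hij)
      have h4 : a j = 0 := by
        rcases mul_eq_zero.1 h2 with h | h
        · exact (mul_eq_zero.1 h).resolve_left hi
        · exact (h3.ne' h).elim
      simp [h4]
  rw [Finset.sum_congr rfl fun j _ => hterm j, ← Finset.sum_smul, ha.1.2, one_smul]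

variable [FiniteDimensional ℝ E]

/-- For a polytope, Hahn–Banach separates an extreme point from the hull of the other points of `S`.
-/
theorem isExposed_singleton_of_mem_extremePoints {S : Finset E} {v : E}
    (hv : v ∈ (convexHull ℝ (S : Set E)).extremePoints ℝ) :
    IsExposed ℝ (convexHull ℝ (S : Set E)) {v} := by
  have hvS : v ∈ S := extremePoints_convexHull_subset hv
  have hnot : v ∉ convexHull ℝ ((S : Set E) \ {v}) := by
    intro h
    rw [(convex_convexHull ℝ _).mem_extremePoints_iff_mem_sdiff_convexHull_sdiff] at hv
    exact hv.2 (convexHull_mono (Set.sdiff_subset_sdiff_left (subset_convexHull ℝ _)) h)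
  obtain ⟨f, u, hfu, hfv⟩ := geometric_hahn_banach_closed_point (convex_convexHull ℝ _)
    ((S.finite_toSet.sdiff (t := {v})).isClosed_convexHull ℝ) hnot
  classical
  let g : E →ᵃ[ℝ] ℝ := (f : E →ₗ[ℝ] ℝ).toAffineMap - AffineMap.const ℝ E (f v)
  have hg : ∀ y, g y = f y - f v := fun y => rfl
  have hlt : ∀ y ∈ S, y ≠ v → g y < 0 := by
    intro y hy hne
    have := hfu y (subset_convexHull ℝ _ ⟨hy, hne⟩)
    rw [hg]
    linarith
  have hle : ∀ y ∈ S, g y ≤ 0 := by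
    intro y hy
    by_cases hne : y = v
    · simp [hne, hg]
    · exact (hlt y hy hne).le
  have := AffineMap.isExposed_of_nonpos g (A := convexHull ℝ (S : Set E))
    fun y hy => AffineMap.nonpos_of_mem_convexHull g hle hy
  convert! this
  ext p
  constructor
  · rintro rfl
    exact ⟨hv.1, by simp [hg]⟩
  · rintro ⟨hp, hp0⟩
    have hp' : p ∈ convexHull ℝ ((fun i : S => (i : E)) '' ((Finset.univ : Finset S) : Set S)) := by
      simpa using hp
    have := mem_convexHull_of_map_eq_zero (fun i : S => (i : E)) g (fun i _ => hle i i.2) hp' hp0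
    have hsub : (fun i : S => (i : E)) ''
        ((Finset.univ.filter fun i : S => g i = 0 : Finset S) : Set S) ⊆ {v} := by
      rintro _ ⟨i, hi, rfl⟩
      by_contra hne
      have h0 : g i = 0 := by simpa using hi
      exact (hlt i i.2 hne).ne h0
    simpa using convexHull_mono hsub this

omit [FiniteDimensional ℝ E] in
theorem convexHull_extremePoints_polytope (S : Finset E) :
    convexHull ℝ ((convexHull ℝ (S : Set E)).extremePoints ℝ) = convexHull ℝ (S : Set E) := by
  have hfin : ((convexHull ℝ (S : Set E)).extremePoints ℝ).Finite :=
    S.finite_toSet.subset extremePoints_convexHull_subset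
  rw [← (hfin.isClosed_convexHull ℝ).closure_eq]
  exact closure_convexHull_extremePoints (S.finite_toSet.isCompact_convexHull ℝ)
    (convex_convexHull ℝ _)

namespace IsGenericLift

variable {Q : QuadraticForm ℝ E} {x : ι → E}

theorem isDelaunay (hG : IsGenericLift x fun i => Q (x i)) (hv : ∃ v, 0 < Q v)
    (hsp : SpacelikePosition Q (Set.range x)) :
    IsDelaunay Q (Set.range x) (lowerCells x fun i => Q (x i)) where
  isCellDecomposition := hG.isCellDecomposition
  exists_ball := by
    rintro _ ⟨I, hI, hIl, rfl⟩
    have hext := hG.extremePoints_convexHull hIl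
    obtain ⟨g, hg, hgI⟩ := hIl
    have hdec : ∀ y, g y = g.linear y + g 0 := fun y => congrFun (AffineMap.decomp g) y
    have hsum : ∀ a ∈ simplexFace I, g (∑ i, a i • x i) = ∑ i, a i * Q (x i) := by
      intro a ha
      rw [AffineMap.map_stdSimplex_sum g x ha.1.2]
      refine Finset.sum_congr rfl fun i _ => ?_
      by_cases hi : i ∈ I
      · rw [hgI i hi, smul_eq_mul]
      · simp [ha.2 i hi]
    refine ⟨qBall Q g.linear (g 0), ⟨_, _, rfl⟩, ⟨?_, ?_⟩, ?_⟩
    · intro p hp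
      obtain ⟨a, ha, rfl⟩ := (mem_convexHull_image_iff x I p).1 hp
      change Q _ ≤ g.linear _ + g 0
      rw [← hdec, hsum a ha]
      exact map_sum_le_of_spacelike Q hsp ha.1
    · rw [hext, frontier_qBall Q hv]
      ext p
      constructor
      · rintro ⟨hp, hpQ⟩
        obtain ⟨a, ha, rfl⟩ := (mem_convexHull_image_iff x I p).1 hp
        change Q _ = g.linear _ + g 0 at hpQ
        rw [← hdec, hsum a ha] at hpQ
        obtain ⟨i, hi, h⟩ := exists_eq_of_map_sum_eq Q hsp ha hpQ
        exact ⟨i, hi, h⟩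
      · rintro ⟨i, hi, rfl⟩
        refine ⟨subset_convexHull ℝ _ ⟨i, hi, rfl⟩, ?_⟩
        exact (hgI i hi).symm.trans (hdec (x i))
    · rw [interior_qBall Q hv, Set.disjoint_left]
      rintro _ ⟨i, rfl⟩ hi
      have := hg i
      rw [hdec] at this
      exact absurd hi (not_lt.2 this)
  unique_ball := by
    rintro _ ⟨I, hI, hIl, rfl⟩ hint B B' ⟨⟨φ, D, rfl⟩, ⟨-, hB⟩, -⟩ ⟨⟨φ', D', rfl⟩, ⟨-, hB'⟩, -⟩
    rw [hG.extremePoints_convexHull hIl, frontier_qBall Q hv] at hB hB'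
    have hspan := interior_convexHull_nonempty_iff_affineSpan_eq_top.1 hint
    have heq : φ.toAffineMap + AffineMap.const ℝ E D =
        φ'.toAffineMap + AffineMap.const ℝ E D' := by
      refine AffineMap.ext_on hspan ?_
      intro y hy
      have h1 : Q y = φ y + D := (hB.ge hy).2
      have h2 : Q y = φ' y + D' := (hB'.ge hy).2
      exact h1.symm.trans h2
    ext y
    have h : φ y + D = φ' y + D' := congrArg (fun f : E →ᵃ[ℝ] ℝ => f y) heq
    simp only [qBall, Set.mem_ofPred_eq, h]

/-- The empty ball of any cell of a competitor `K` is an affine lower bound touching at the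
vertices, so `K` consists of lower cells; since `K` covers the hull and is closed under faces, it
contains them all. -/
theorem isTheDelaunay (hG : IsGenericLift x fun i => Q (x i)) (hv : ∃ v, 0 < Q v)
    (hsp : SpacelikePosition Q (Set.range x)) :
    IsTheDelaunay Q (Set.range x) (lowerCells x fun i => Q (x i)) := by
  classical
  refine ⟨hG.isDelaunay hv hsp, fun K hK => ?_⟩
  have hcell : ∀ C ∈ K, ∃ I : Finset ι, I.Nonempty ∧ IsLowerFace x (fun i => Q (x i)) I ∧
      convexHull ℝ (x '' (I : Set ι)) = C := by
    intro C hC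
    obtain ⟨S, hS, rfl⟩ := hK.isCellDecomposition.polytope C hC
    have hext : (convexHull ℝ (S : Set E)).extremePoints ℝ ⊆ Set.range x := by
      intro v hv'
      rw [← hK.isCellDecomposition.zero_skeleton]
      exact hK.isCellDecomposition.face_mem _ hC _ (Set.singleton_nonempty v)
        (isExposed_singleton_of_mem_extremePoints hv')
    obtain ⟨_, ⟨φ, D, rfl⟩, ⟨-, hB⟩, hdisj⟩ := hK.exists_ball _ hC
    rw [frontier_qBall Q hv] at hB
    rw [interior_qBall Q hv, Set.disjoint_left] at hdisj
    have hI : x '' ((Finset.univ.filter fun i =>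
        x i ∈ (convexHull ℝ (S : Set E)).extremePoints ℝ : Finset ι) : Set ι) =
        (convexHull ℝ (S : Set E)).extremePoints ℝ := by
      ext y
      constructor
      · rintro ⟨i, hi, rfl⟩
        simpa using hi
      · intro hy
        obtain ⟨i, rfl⟩ := hext hy
        exact ⟨i, by simpa using hy, rfl⟩
    refine ⟨Finset.univ.filter fun i => x i ∈ (convexHull ℝ (S : Set E)).extremePoints ℝ,
      ?_, ?_, ?_⟩
    · rw [← Finset.coe_nonempty, ← Set.image_nonempty (f := x), hI, ← convexHull_nonempty_iff (𝕜 := ℝ),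
        convexHull_extremePoints_polytope]
      simpa using hS
    · refine ⟨φ.toAffineMap + AffineMap.const ℝ E D, fun i => ?_, fun i hi => ?_⟩
      · exact not_lt.1 (hdisj ⟨i, rfl⟩)
      · exact (hB.ge (by simpa using hi : x i ∈ _)).2.symm
    · rw [hI, convexHull_extremePoints_polytope]
  apply Set.Subset.antisymm
  · exact hcell
  · rintro _ ⟨I, hI, hIl, rfl⟩
    have hcpos : (0 : ℝ) < I.card := by exact_mod_cast hI.card_pos
    -- The barycentre has full support, so a cell of `K` containing it has all of `I` among its
    -- vertices.
    set a : ι → ℝ := fun i => if i ∈ I then (I.card : ℝ)⁻¹ else 0 with ha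
    have haI : a ∈ simplexFace I := by
      refine ⟨⟨fun i => ?_, ?_⟩, fun i hi => by simp [ha, hi]⟩
      · simp only [ha]
        split_ifs
        · positivity
        · exact le_rfl
      · simp [ha, hcpos.ne']
    have hp : ∑ i, a i • x i ∈ ⋃₀ K := by
      rw [hK.isCellDecomposition.sUnion_eq]
      exact convexHull_mono (Set.image_subset_range _ _)
        ((mem_convexHull_image_iff x I _).2 ⟨a, haI, rfl⟩)
    obtain ⟨C, hC, hpC⟩ := hp
    obtain ⟨J, hJ, hJl, rfl⟩ := hcell C hC
    obtain ⟨b, hb, hbx⟩ := (mem_convexHull_image_iff x J _).1 hpC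
    have hab := hG.eq_of_sum_eq hIl hJl haI hb hbx.symm
    have hIJ : I ⊆ J := by
      intro i hi
      by_contra hiJ
      have h0 : a i = 0 := hab ▸ hb.2 i hiJ
      simp [ha, hi, hcpos.ne'] at h0
    refine hK.isCellDecomposition.face_mem _ hC _ ?_ (hG.isExposed_convexHull hJl hIJ)
    rw [convexHull_nonempty_iff, Set.image_nonempty]
    exact hI

end IsGenericLift

end DelaunayExistence

/-! ### Affine interpolation near an affine basis. -/

section Interpolation

variable {σ E : Type*} [Fintype σ] [NormedAddCommGroup E] [NormedSpace ℝ E]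

/-- The affine function with prescribed values on an affine basis. -/
noncomputable def AffineBasis.interpolate (b : AffineBasis σ ℝ E) (u : σ → ℝ) : E →ᵃ[ℝ] ℝ :=
  (Fintype.linearCombination ℝ u).toAffineMap.comp b.coords

theorem AffineBasis.interpolate_apply (b : AffineBasis σ ℝ E) (u : σ → ℝ) (y : E) :
    b.interpolate u y = ∑ i, b.coord i y * u i := rfl

theorem AffineBasis.interpolate_self (b : AffineBasis σ ℝ E) (u : σ → ℝ) (i : σ) :
    b.interpolate u (b i) = u i := by
  classical
  simp [AffineBasis.interpolate_apply, AffineBasis.coord_apply]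

variable {τ : Type*} {l : Filter τ} {y : τ → σ → E}

variable [FiniteDimensional ℝ E]

theorem AffineBasis.tendsto_interpolate (b : AffineBasis σ ℝ E) {u : τ → σ → ℝ} {u₀ : σ → ℝ}
    (hu : Filter.Tendsto u l (𝓝 u₀)) {z : τ → E} {z₀ : E} (hz : Filter.Tendsto z l (𝓝 z₀)) :
    Filter.Tendsto (fun t => b.interpolate (u t) (z t)) l (𝓝 (b.interpolate u₀ z₀)) := by
  simp_rw [AffineBasis.interpolate_apply]
  exact tendsto_finsetSum _ fun i _ =>
    (((continuous_barycentric_coord b i).tendsto z₀).comp hz).mul (tendsto_pi_nhds.1 hu i)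

omit [Fintype σ] in
theorem AffineBasis.tendsto_toMatrix [DecidableEq σ] (b : AffineBasis σ ℝ E)
    (hy : ∀ i, Filter.Tendsto (fun t => y t i) l (𝓝 (b i))) :
    Filter.Tendsto (fun t => b.toMatrix (y t)) l (𝓝 1) := by
  rw [← b.toMatrix_self]
  refine tendsto_pi_nhds.2 fun i => tendsto_pi_nhds.2 fun j => ?_
  exact ((continuous_barycentric_coord b j).tendsto (b i)).comp (hy i)

theorem AffineBasis.eventually_isUnit_toMatrix [DecidableEq σ] (b : AffineBasis σ ℝ E)
    (hy : ∀ i, Filter.Tendsto (fun t => y t i) l (𝓝 (b i))) :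
    ∀ᶠ t in l, IsUnit (b.toMatrix (y t)) := by
  have hdet : Filter.Tendsto (fun t => (b.toMatrix (y t)).det) l (𝓝 1) := by
    have := ((Continuous.matrix_det continuous_id).tendsto (1 : Matrix σ σ ℝ)).comp
      (b.tendsto_toMatrix hy)
    simpa [Function.comp_def] using this
  filter_upwards [hdet.eventually_ne one_ne_zero] with t ht
  rw [Matrix.isUnit_iff_isUnit_det]
  exact ht.isUnit

theorem AffineBasis.eventually_affineIndependent (b : AffineBasis σ ℝ E)
    (hy : ∀ i, Filter.Tendsto (fun t => y t i) l (𝓝 (b i))) :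
    ∀ᶠ t in l, AffineIndependent ℝ (y t) ∧ affineSpan ℝ (Set.range (y t)) = ⊤ := by
  classical
  filter_upwards [b.eventually_isUnit_toMatrix hy] with t ht
  exact (b.isUnit_toMatrix_iff (y t)).1 ht

/-- Interpolation at points close to an affine basis is close to interpolation at the basis. -/
theorem AffineBasis.exists_tendsto_interpolation (b : AffineBasis σ ℝ E)
    (hy : ∀ i, Filter.Tendsto (fun t => y t i) l (𝓝 (b i))) {u : τ → σ → ℝ} {u₀ : σ → ℝ}
    (hu : Filter.Tendsto u l (𝓝 u₀)) :
    ∃ a : τ → σ → ℝ, Filter.Tendsto a l (𝓝 u₀) ∧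
      ∀ᶠ t in l, ∀ i, b.interpolate (a t) (y t i) = u t i := by
  classical
  have hM := b.tendsto_toMatrix hy
  -- The values at the fixed basis solve a linear system whose matrix tends to the identity.
  refine ⟨fun t => ((b.toMatrix (y t))⁻¹).mulVec (u t), ?_, ?_⟩
  · have hinv : Filter.Tendsto (fun t => (b.toMatrix (y t))⁻¹) l (𝓝 1) := by
      have hdet := ((Continuous.matrix_det continuous_id).tendsto (1 : Matrix σ σ ℝ)).comp hM
      have hadj := ((Continuous.matrix_adjugate continuous_id).tendsto (1 : Matrix σ σ ℝ)).comp hM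
      simp only [id, Matrix.det_one, Matrix.adjugate_one] at hdet hadj
      have := (hdet.inv₀ one_ne_zero).smul hadj
      simpa [Matrix.inv_def, Ring.inverse_eq_inv', Function.comp_def] using this
    have := ((continuous_fst.matrix_mulVec continuous_snd).tendsto
      ((1 : Matrix σ σ ℝ), u₀)).comp (hinv.prodMk_nhds hu)
    simpa [Function.comp_def] using this
  · filter_upwards [b.eventually_isUnit_toMatrix hy] with t ht i
    rw [Matrix.isUnit_iff_isUnit_det] at ht
    have h : (b.toMatrix (y t)).mulVec (((b.toMatrix (y t))⁻¹).mulVec (u t)) i = u t i := by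
      rw [Matrix.mulVec_mulVec, Matrix.mul_nonsing_inv _ ht, Matrix.one_mulVec]
    exact h

end Interpolation

/-! ### Stability of generic lifts under perturbation. -/

section Stability

variable {ι E τ : Type*} [Fintype ι] [NormedAddCommGroup E] [NormedSpace ℝ E]
  [FiniteDimensional ℝ E] {l : Filter τ} {x₀ : ι → E} {w₀ : ι → ℝ} {x : τ → ι → E} {w : τ → ι → ℝ}

namespace IsGenericLift

/-- On a facet `T` genericity makes the lower bound strict off `T`, and strict inequalities survive
for the perturbed interpolant. -/
theorem eventually_isLowerFace (hG : IsGenericLift x₀ w₀)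
    (hx : ∀ i, Filter.Tendsto (fun t => x t i) l (𝓝 (x₀ i)))
    (hw : ∀ i, Filter.Tendsto (fun t => w t i) l (𝓝 (w₀ i))) {I : Finset ι}
    (hI : IsLowerFace x₀ w₀ I) : ∀ᶠ t in l, IsLowerFace (x t) (w t) I := by
  classical
  obtain ⟨T, hIT, hT, g, hg, hgT⟩ := hG.exists_facet hI
  obtain ⟨a, ha, hinterp⟩ := (hG.basis hT).exists_tendsto_interpolation
    (y := fun t (i : T) => x t i) (fun i => hx i)
        (u := fun t (i : T) => w t i) (u₀ := fun i : T => w₀ i)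
    (tendsto_pi_nhds.2 fun i => hw i)
  have hg₀ : (hG.basis hT).interpolate (fun i => w₀ i) = g := by
    refine AffineMap.ext_on (hG.basis hT).tot ?_
    rintro _ ⟨i, rfl⟩
    rw [AffineBasis.interpolate_self, basis_apply, hgT i i.2]
  have hlt : ∀ j ∉ T, ∀ᶠ t in l, (hG.basis hT).interpolate (a t) (x t j) < w t j := by
    intro j hj
    refine ((hG.basis hT).tendsto_interpolate ha (hx j)).eventually_lt (hw j) ?_
    rw [hg₀]
    refine lt_of_le_of_ne (hg j) fun heq => ?_
    have := hG.card_le_of_forall_eq (I := insert j T) (g := g) (by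
      intro i hi
      rcases Finset.mem_insert.1 hi with rfl | hi
      · exact heq
      · exact hgT i hi)
    rw [Finset.card_insert_of_notMem hj] at this
    omega
  have hall : ∀ᶠ t in l, ∀ j, j ∉ T → (hG.basis hT).interpolate (a t) (x t j) < w t j := by
    rw [Filter.eventually_all]
    intro j
    by_cases hj : j ∈ T
    · exact Filter.Eventually.of_forall fun t h => (h hj).elim
    · exact (hlt j hj).mono fun t h _ => h
  filter_upwards [hinterp, hall] with t h1 h2
  refine IsLowerFace.mono ⟨_, fun i => ?_, fun i hi => h1 ⟨i, hi⟩⟩ hIT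
  by_cases hi : i ∈ T
  · exact (h1 ⟨i, hi⟩).le
  · exact (h2 i hi).le

/-- With `d + 1` points the interpolant is the only candidate, and its strict violation at some `j`
persists. -/
theorem eventually_not_isLowerFace (hG : IsGenericLift x₀ w₀)
    (hx : ∀ i, Filter.Tendsto (fun t => x t i) l (𝓝 (x₀ i)))
    (hw : ∀ i, Filter.Tendsto (fun t => w t i) l (𝓝 (w₀ i))) {T : Finset ι}
    (hT : T.card = Module.finrank ℝ E + 1) (hTl : ¬ IsLowerFace x₀ w₀ T) :
    ∀ᶠ t in l, ¬ IsLowerFace (x t) (w t) T := by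
  obtain ⟨a, ha, hinterp⟩ := (hG.basis hT).exists_tendsto_interpolation
    (y := fun t (i : T) => x t i) (fun i => hx i)
        (u := fun t (i : T) => w t i) (u₀ := fun i : T => w₀ i)
    (tendsto_pi_nhds.2 fun i => hw i)
  obtain ⟨j, hj⟩ : ∃ j, w₀ j < (hG.basis hT).interpolate (fun i => w₀ i) (x₀ j) := by
    by_contra! hle
    exact hTl ⟨_, hle, fun i hi => (hG.basis hT).interpolate_self _ ⟨i, hi⟩⟩
  filter_upwards [hinterp, (hw j).eventually_lt ((hG.basis hT).tendsto_interpolate ha (hx j)) hj,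
    (hG.basis hT).eventually_affineIndependent (y := fun t (i : T) => x t i) fun i => hx i]
    with t h1 h2 h3
  rintro ⟨g, hg, hgT⟩
  have heq : g = (hG.basis hT).interpolate (a t) := by
    refine AffineMap.ext_on h3.2 ?_
    rintro _ ⟨i, rfl⟩
    exact (hgT i i.2).trans (h1 i).symm
  exact (hg j).not_gt (heq ▸ h2)

theorem eventually_isGenericLift (hG : IsGenericLift x₀ w₀)
    (hx : ∀ i, Filter.Tendsto (fun t => x t i) l (𝓝 (x₀ i)))
    (hw : ∀ i, Filter.Tendsto (fun t => w t i) l (𝓝 (w₀ i))) :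
    ∀ᶠ t in l, IsGenericLift (x t) (w t) := by
  classical
  have h1 : ∀ᶠ t in l, ∀ T : Finset ι, T.card = Module.finrank ℝ E + 1 →
      AffineIndependent ℝ fun i : T => x t i := by
    rw [Filter.eventually_all]
    intro T
    rw [Filter.eventually_imp_distrib_left]
    intro hT
    exact ((hG.basis hT).eventually_affineIndependent (y := fun t (i : T) => x t i)
      fun i => hx i).mono fun t h => h.1
  have h2 : ∀ᶠ t in l, ∀ T : Finset ι, T.card = Module.finrank ℝ E + 2 →
      ∀ g : E →ᵃ[ℝ] ℝ, ∃ i ∈ T, g (x t i) ≠ w t i := by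
    rw [Filter.eventually_all]
    intro T
    rw [Filter.eventually_imp_distrib_left]
    intro hT
    obtain ⟨j, hj⟩ : T.Nonempty := Finset.card_pos.1 (by omega)
    have hT' : (T.erase j).card = Module.finrank ℝ E + 1 := by
      rw [Finset.card_erase_of_mem hj]
      omega
    obtain ⟨a, ha, hinterp⟩ := (hG.basis hT').exists_tendsto_interpolation
      (y := fun t (i : ↥(T.erase j)) => x t i) (fun i => hx i)
        (u := fun t (i : ↥(T.erase j)) => w t i) (u₀ := fun i : ↥(T.erase j) => w₀ i)
      (tendsto_pi_nhds.2 fun i => hw i)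
    -- Interpolating all but one of the `d + 2` points leaves a nonzero residual at the last, an
    -- open condition.
    have hne : (hG.basis hT').interpolate (fun i => w₀ i) (x₀ j) ≠ w₀ j := by
      intro heq
      obtain ⟨i, hi, hne⟩ := hG.exists_ne T hT ((hG.basis hT').interpolate fun i => w₀ i)
      apply hne
      by_cases hij : i = j
      · rw [hij, heq]
      · exact (hG.basis hT').interpolate_self _ ⟨i, Finset.mem_erase.2 ⟨hij, hi⟩⟩
    have hsub : Filter.Tendsto
        (fun t => (hG.basis hT').interpolate (a t) (x t j) - w t j) l
        (𝓝 ((hG.basis hT').interpolate (fun i => w₀ i) (x₀ j) - w₀ j)) :=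
      ((hG.basis hT').tendsto_interpolate ha (hx j)).sub (hw j)
    filter_upwards [hinterp, hsub.eventually_ne (sub_ne_zero.2 hne),
      (hG.basis hT').eventually_affineIndependent (y := fun t (i : ↥(T.erase j)) => x t i) fun i => hx i]
      with t h1 h2 h3 g
    by_contra! hall
    have heq : g = (hG.basis hT').interpolate (a t) := by
      refine AffineMap.ext_on h3.2 ?_
      rintro _ ⟨i, rfl⟩
      exact (hall i (Finset.mem_of_mem_erase i.2)).trans (h1 i).symm
    exact h2 (by rw [← heq, hall j hj, sub_self])
  have h3 : ∀ᶠ t in l, ∀ i, IsLowerFace (x t) (w t) {i} :=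
    Filter.eventually_all.2 fun i => hG.eventually_isLowerFace hx hw (hG.singleton i)
  filter_upwards [h1, h2, h3] with t h1 h2 h3
  exact ⟨hG.card_le, h1, h2, h3⟩

/-- The lower faces of a generic lift are stable under small perturbations. -/
theorem eventually_isLowerFace_iff (hG : IsGenericLift x₀ w₀)
    (hx : ∀ i, Filter.Tendsto (fun t => x t i) l (𝓝 (x₀ i)))
    (hw : ∀ i, Filter.Tendsto (fun t => w t i) l (𝓝 (w₀ i))) :
    ∀ᶠ t in l, ∀ I, IsLowerFace (x t) (w t) I ↔ IsLowerFace x₀ w₀ I := by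
  have h1 : ∀ᶠ t in l, ∀ I, IsLowerFace x₀ w₀ I → IsLowerFace (x t) (w t) I := by
    simp only [Filter.eventually_all]
    exact fun I hI => hG.eventually_isLowerFace hx hw hI
  have h2 : ∀ᶠ t in l, ∀ T : Finset ι, T.card = Module.finrank ℝ E + 1 → ¬ IsLowerFace x₀ w₀ T →
      ¬ IsLowerFace (x t) (w t) T := by
    simp only [Filter.eventually_all]
    exact fun T hT hTl => hG.eventually_not_isLowerFace hx hw hT hTl
  filter_upwards [h1, h2, hG.eventually_isGenericLift hx hw] with t h1 h2 h3 I
  refine ⟨fun hI => ?_, h1 I⟩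
  -- Smaller faces reduce to facets at time `t`, since the perturbed lift is generic too.
  obtain ⟨T, hIT, hT, hTl⟩ := h3.exists_facet hI
  exact (not_not.1 fun h => h2 T hT h hTl : IsLowerFace x₀ w₀ T).mono hIT

end IsGenericLift

end Stability

/-! ### Invariance under affine equivalences. -/

section Transport

variable {ι E : Type*} [NormedAddCommGroup E] [NormedSpace ℝ E]

theorem isLowerFace_comp_affineEquiv (e : E ≃ᵃ[ℝ] E) (x : ι → E) (w : ι → ℝ) (I : Finset ι) :
    IsLowerFace (fun i => e (x i)) w I ↔ IsLowerFace x w I := by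
  constructor
  · rintro ⟨g, h1, h2⟩
    exact ⟨g.comp e.toAffineMap, h1, h2⟩
  · rintro ⟨g, h1, h2⟩
    exact ⟨g.comp e.symm.toAffineMap, by simpa using h1, by simpa using h2⟩

theorem IsGenericLift.comp_affineEquiv [Fintype ι] (e : E ≃ᵃ[ℝ] E) {x : ι → E} {w : ι → ℝ}
    (hG : IsGenericLift x w) : IsGenericLift (fun i => e (x i)) w where
  card_le := hG.card_le
  affineIndependent T hT := e.affineIndependent_iff.2 (hG.affineIndependent T hT)
  exists_ne T hT g := hG.exists_ne T hT (g.comp e.toAffineMap)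
  singleton i := (isLowerFace_comp_affineEquiv e x w _).2 (hG.singleton i)

end Transport

theorem exists_pos_of_spacelike {ι E : Type*} [Nontrivial ι] [NormedAddCommGroup E]
    [NormedSpace ℝ E] {Q : QuadraticForm ℝ E} {x : ι → E} (hx : Function.Injective x)
    (hsp : SpacelikePosition Q (Set.range x)) : ∃ v, 0 < Q v := by
  obtain ⟨i, j, hij⟩ := exists_pair_ne ι
  exact ⟨_, hsp _ ⟨i, rfl⟩ _ ⟨j, rfl⟩ (hx.ne hij)⟩

/-! ### The rescaling `z ↦ z / t` and its limit. -/

section Rescaling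

variable {m k : ℕ}

/-- The linear map `(y, z) ↦ (y, t z)`. -/
noncomputable def scaleSnd (m k : ℕ) {t : ℝ} (ht : t ≠ 0) :
    ((Fin m → ℝ) × (Fin k → ℝ)) ≃ₗ[ℝ] ((Fin m → ℝ) × (Fin k → ℝ)) :=
  (LinearEquiv.refl ℝ _).prodCongr (LinearEquiv.smulOfNeZero ℝ _ t ht)

theorem scaleSnd_apply {t : ℝ} (ht : t ≠ 0) (y : Fin m → ℝ) (z : Fin k → ℝ) :
    scaleSnd m k ht (y, z) = (y, t • z) := rfl

variable {p : ℝ → (Fin m → ℝ) × (Fin k → ℝ)}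

theorem tendsto_nhdsGT_of_contDiffOn (hp : ContDiffOn ℝ ∞ p (Set.Ici 0)) :
    Filter.Tendsto p (𝓝[>] 0) (𝓝 (p 0)) :=
  (hp.continuousOn 0 Set.self_mem_Ici).mono_left (nhdsWithin_mono 0 Set.Ioi_subset_Ici_self)

/-- As the second component vanishes at `0`, the rescaled one is its difference quotient. -/
theorem tendsto_rescaledLimit (hp : ContDiffOn ℝ ∞ p (Set.Ici 0)) (hp0 : (p 0).2 = 0) :
    Filter.Tendsto (fun t => ((p t).1, t⁻¹ • (p t).2)) (𝓝[>] 0) (𝓝 (rescaledLimit p)) := by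
  refine Filter.Tendsto.prodMk_nhds ?_ ?_
  · exact (continuous_fst.tendsto _).comp (tendsto_nhdsGT_of_contDiffOn hp)
  · have hdiff : DifferentiableWithinAt ℝ (fun t => (p t).2) (Set.Ici 0) 0 :=
      ((hp.differentiableOn (by simp)) 0 Set.self_mem_Ici).snd
    have := (hasDerivWithinAt_Ioi_iff_Ici.2 hdiff.hasDerivWithinAt)
    rw [hasDerivWithinAt_iff_tendsto_slope' (by simp)] at this
    refine this.congr fun t => ?_
    simp [slope_def_module, hp0]

end Rescaling

/-! ### The degeneration theorem. -/

theorem mainTheorem2 {m k n : ℕ} (hk : 0 < k) (hn : m + k + 1 ≤ n)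
    (Q : QuadraticForm ℝ ((Fin m → ℝ) × (Fin k → ℝ)))
    (hQ : (QuadraticMap.associated (R := ℝ) Q).Nondegenerate)
    (hortho : ∀ (y : Fin m → ℝ) (z : Fin k → ℝ), Q.IsOrtho (y, 0) (0, z))
    (p : Fin n → ℝ → (Fin m → ℝ) × (Fin k → ℝ))
    (hp : ∀ i, ContDiffOn ℝ ∞ (p i) (Set.Ici 0))
    (hp0 : ∀ i, (p i 0).2 = 0)
    (hinj : Function.Injective fun i => rescaledLimit (p i))
    (hspace : SpacelikePosition (degenerateForm Q) (Set.range fun i => rescaledLimit (p i)))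
    (hgen : GenericPosition (degenerateForm Q) (Set.range fun i => rescaledLimit (p i))) :
    ∃ K : Set (Set ((Fin m → ℝ) × (Fin k → ℝ))),
      IsTheDelaunay (degenerateForm Q) (Set.range fun i => rescaledLimit (p i)) K ∧
      ∀ᶠ t in 𝓝[>] (0 : ℝ),
        SpacelikePosition Q (Set.range fun i => p i t) ∧
        GenericPosition Q (Set.range fun i => p i t) ∧
        ∃ Kt : Set (Set ((Fin m → ℝ) × (Fin k → ℝ))),
          IsTheDelaunay Q (Set.range fun i => p i t) Kt ∧
          (∃ h : convexHull ℝ (Set.range fun i => p i t) ≃ₜ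
              convexHull ℝ (Set.range fun i => rescaledLimit (p i)),
            IsCellwise Kt K h ∧
            ∀ i (hi : p i t ∈ convexHull ℝ (Set.range fun j => p j t)),
              (h ⟨p i t, hi⟩ : (Fin m → ℝ) × (Fin k → ℝ)) = rescaledLimit (p i)) ∧
          ∀ I : Set (Fin n),
            convexHull ℝ ((fun i => p i t) '' I) ∈ Kt ↔
              convexHull ℝ ((fun i => rescaledLimit (p i)) '' I) ∈ K := by
  -- Two distinct points, available since `k ≥ 1`, supply a vector on which the form is positive.
  have : Nontrivial (Fin n) := Fin.nontrivial_iff_two_le.2 (by omega)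
  have hv := exists_pos_of_spacelike hinj hspace
  have hG := isGenericLift_of_genericPosition (degenerateForm Q) hv hinj
    (by simpa using hn) hspace hgen
  have hlim : ∀ i, Filter.Tendsto (p i) (𝓝[>] 0) (𝓝 (p i 0)) := fun i =>
    tendsto_nhdsGT_of_contDiffOn (hp i)
  have hQc := Q.continuous_of_finiteDimensional
  have hw : ∀ i, Filter.Tendsto (fun t => Q (p i t)) (𝓝[>] 0)
      (𝓝 (degenerateForm Q (rescaledLimit (p i)))) := by
    intro i
    -- The heights are those of the unscaled points; as `z_i(0) = 0`, their limit is the degenerate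
    -- form at `q_i`.
    have : degenerateForm Q (rescaledLimit (p i)) = Q (p i 0) := by
      rw [rescaledLimit, degenerateForm_apply, ← hp0 i]
    rw [this]
    exact (hQc.tendsto _).comp (hlim i)
  have hx := fun i => tendsto_rescaledLimit (hp i) (hp0 i)
  have hpos : ∀ᶠ t in 𝓝[>] (0 : ℝ), ∀ i j, i ≠ j → 0 < Q (p i t - p j t) := by
    simp only [Filter.eventually_all]
    intro i j hij
    have h0 : degenerateForm Q (rescaledLimit (p i) - rescaledLimit (p j)) =
        Q (p i 0 - p j 0) := by
      have : p i 0 - p j 0 = ((p i 0).1 - (p j 0).1, 0) := by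
        ext1 <;> simp [hp0]
      rw [this]
      rfl
    have h1 := hspace _ ⟨i, rfl⟩ _ ⟨j, rfl⟩ (hinj.ne hij)
    exact ((hQc.tendsto _).comp ((hlim i).sub (hlim j))).eventually_const_lt (h0 ▸ h1)
  refine ⟨_, hG.isTheDelaunay hv hspace, ?_⟩
  filter_upwards [hpos, hG.eventually_isGenericLift (x := fun t i => ((p i t).1, t⁻¹ • (p i t).2)) hx hw,
    hG.eventually_isLowerFace_iff (x := fun t i => ((p i t).1, t⁻¹ • (p i t).2)) hx hw,
    self_mem_nhdsWithin] with t hpos hGt hiff ht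
  have ht0 : t ≠ 0 := (Set.mem_Ioi.1 ht).ne'
  have hscale : (fun i => (scaleSnd m k ht0).toAffineEquiv ((p i t).1, t⁻¹ • (p i t).2)) =
      fun i => p i t := by
    funext i
    simp [scaleSnd_apply, smul_smul, ht0]
  have hG' := hGt.comp_affineEquiv (scaleSnd m k ht0).toAffineEquiv
  rw [hscale] at hG'
  have hiff' : ∀ I, IsLowerFace (fun i => p i t) (fun i => Q (p i t)) I ↔
      IsLowerFace (fun i => rescaledLimit (p i))
        (fun i => degenerateForm Q (rescaledLimit (p i))) I := by
    intro I
    have h := isLowerFace_comp_affineEquiv (scaleSnd m k ht0).toAffineEquiv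
      (fun i => ((p i t).1, t⁻¹ • (p i t).2)) (fun i => Q (p i t)) I
    rw [hscale] at h
    exact h.trans (hiff I)
  have hinjt : Function.Injective fun i => p i t := by
    intro i j hij
    by_contra hne
    have := hpos i j hne
    simp only at hij
    simp [hij] at this
  have hspt : SpacelikePosition Q (Set.range fun i => p i t) := by
    rintro _ ⟨i, rfl⟩ _ ⟨j, rfl⟩ hne
    exact hpos i j fun h => hne (by rw [h])
  have hvt := exists_pos_of_spacelike hinjt hspt
  refine ⟨hspt, hG'.genericPosition hvt hinjt, _, hG'.isTheDelaunay hvt hspt,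
    hG'.exists_homeomorph hG hiff', fun I => ?_⟩
  lift I to Finset (Fin n) using Set.toFinite I
  rw [hG'.convexHull_mem_lowerCells_iff, hG.convexHull_mem_lowerCells_iff, hiff']
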